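/- Let $\mathbb F$ be a field of characteristic $p\ge 0$, let $n\ge 1$, and let $U_1,\dots,U_n$ be finite sets with $|U_i|\ge 2$. Put $X=U_1\times\cdots\times U_n$ and fix $x\in X$. Let $E=\{0,1\}^n$; identify $g\in E$ with the set $\{i: g_i=1\}$, so that set operations apply to elements of $E$. The *factorial scheme* on $X$ is the direct product of the trivial schemes on $U_1,\dots,U_n$: its relations are $R_g=\{(y,z): y_i\neq z_i \iff i\in g\}$ for $g\in E$, with valencies $k_g=\prod_{i\in g}(|U_i|-1)$. Let $A_g\in \mathrm M_X(\mathbb F)$ be the adjacency matrix of $R_g$, and $E_g^*$ the diagonal $0$-$1$ matrix with $(y,y)$-entry $1$ if and only if $(x,y)\in R_g$. The *Terwilliger algebra* $\mathbb T$ is the $\mathbb F$-subalgebra of $\mathrm M_X(\mathbb F)$ generated by all $A_g$ and $E_g^*$, and $\alpha_T:M\mapsto M^T$ is its transposition anti-automorphism. $\mathrm{Rad}(\mathbb T)$ is the Jacobson radical. For $V\subseteq\{1,\dots,n\}$ put $V^\circ=\{i\in V:|U_i|>2\}$, and for $g,i\in E$ put $gi=(g\triangle i)\cup(g\cap i)^\circ$.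 Let $$\mathbb D=\{(a,b,c)\in E^3:\ a\triangle c\subseteq b\subseteq ac,\ p\nmid k_b\}.$$ For $(g,h,i)\in\mathbb D$ let $$B_{g,l,i}=\sum_{g\triangle i\subseteq j\subseteq l}E_g^*A_jE_i^*,\qquad D_{g,h,i}=\sum_{h\subseteq l\subseteq gi,\ p\nmid k_l}(-1)^{|l\setminus h|}\,k_{i\cap l}^{-1}\,B_{g,l,i}\in\mathbb T .$$ Let $\sim$ be the equivalence relation on $\mathbb D$ given by $(g,h,i)\sim(j,k,l)$ if and only if $(g\cap i)^\circ\setminus h=(j\cap l)^\circ\setminus k$, and let $\mathbb D_1,\dots,\mathbb D_{n_\sim}$ be its distinct equivalence classes. For $1\le m\le n_\sim$ let $\mathbb D(m)=\{a: (a,b,a)\in\mathbb D_m\text{ for some }b\}$, choose $h\in\mathbb D(m)$, and let $\mathrm{Irr}(m)$ be the $\mathbb F$-linear span in $\mathbb T/\mathrm{Rad}(\mathbb T)$ of the elements $D_{a,b,h}+\mathrm{Rad}(\mathbb T)$ with $a\in\mathbb D(m)$ and $(a,b,h)\in\mathbb D_m$. Then $n_\sim\geq 1$ and every $\mathbb D(m)$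 is nonempty, and: 1. Under left multiplication each $\mathrm{Irr}(m)$ is an irreducible $\mathbb T$-module, which up to isomorphism does not depend on the choice of $h\in\mathbb D(m)$. For $m,m'\in[1,n_\sim]$, $\mathrm{Irr}(m)\cong\mathrm{Irr}(m')$ as $\mathbb T$-modules if and only if $m=m'$. Every irreducible $\mathbb T$-module is isomorphic to $\mathrm{Irr}(m)$ for some $m\in[1,n_\sim]$. In particular, up to isomorphism, the irreducible $\mathbb T$-modules form a nonempty finite set. 2. A $\mathbb T$-module $M$ is irreducible if and only if it is absolutely irreducible, i.e. $\mathbb L\otimes_{\mathbb F}M$ is an irreducible $\mathbb L\otimes_{\mathbb F}\mathbb T$-module for every extension field $\mathbb L$ of $\mathbb F$. 3. Every irreducible $\mathbb T$-module $M$ is self-contragredient with respect to $\alpha_T$: $M\cong\mathrm{Hom}_{\mathbb F}(M,\mathbb F)$ as $\mathbb T$-modules, where $\mathbb T$ acts on $\mathrm{Hom}_{\mathbb F}(M,\mathbb F)$ by $(f\beta)(u)=\beta(\alpha_T(f)u)$. -/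

import Mathlib

open scoped TensorProduct symmDiff

universe u v w w'

noncomputable section

/-! ### Association schemes -/

/-- An association scheme on the finite set `X` with index set `E`. The relations are nonempty and
partition `X × X`, so `zero`, `star` and `p` are uniquely determined by `rel`. -/
structure AssociationScheme (X E : Type*) [Finite X] [Finite E] where
  rel : E → X → X → Prop
  existsUnique_rel : ∀ x y, ∃! g, rel g x y
  rel_nonempty : ∀ g, ∃ x y, rel g x y
  /-- the index of the diagonal relation -/
  zero : E
  rel_zero : ∀ x y, rel zero x y ↔ x = y
  /-- the index of the converse relation -/
  star : E → E
  rel_star : ∀ g x y, rel (star g) x y ↔ rel g y x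
  /-- the intersection numbers: `p g h i` is usually written `p_{g,h}^i` -/
  p : E → E → E → ℕ
  card_rel : ∀ g h i x y, rel i x y → Nat.card {a // rel g x a ∧ rel h a y} = p g h i

namespace AssociationScheme

/-- The valency `k_g = p_{g,g*}^0`. -/
def valency {X E : Type*} [Finite X] [Finite E] (S : AssociationScheme X E) (g : E) : ℕ :=
  S.p g (S.star g) S.zero

/-- The number of `a` with `x R_g a` and `a R_h y` when `x R_i y`, where `R_0` is equality and `R_1`
is inequality on `U`. -/
def trivialP (U : Type*) (g h i : Fin 2) : ℕ :=
  if g = 0 then (if h = i then 1 else 0)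
  else if h = 0 then (if g = i then 1 else 0)
  else if i = 0 then Nat.card U - 1
  else Nat.card U - 2

theorem trivial_card (U : Type*) [Finite U] (g h i : Fin 2) (x y : U)
    (hxy : i = 0 ↔ x = y) :
    Nat.card {a : U // (g = 0 ↔ x = a) ∧ (h = 0 ↔ a = y)} = trivialP U g h i := by
  classical
  have := Fintype.ofFinite U
  rw [Nat.card_eq_fintype_card, Fintype.card_subtype]
  by_cases hg : g = 0
  · have e : (Finset.univ.filter fun a : U => (g = 0 ↔ x = a) ∧ (h = 0 ↔ a = y)) =
        if h = i then {x} else ∅ := by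
      ext a
      split_ifs with hi
      · subst hi; simp only [hg, Finset.mem_filter, Finset.mem_univ, true_and, true_iff,
          Finset.mem_singleton]
        exact ⟨fun H => H.1.symm, fun H => ⟨H.symm, by rw [H]; exact hxy⟩⟩
      · simp only [hg, Finset.mem_filter, Finset.mem_univ, true_and, true_iff,
          Finset.notMem_empty, iff_false, not_and]
        rintro rfl H
        have : h = 0 ↔ i = 0 := H.trans hxy.symm
        omega
    rw [e, trivialP, if_pos hg]
    split_ifs <;> simp
  · by_cases hh : h = 0
    · have e : (Finset.univ.filter fun a : U => (g = 0 ↔ x = a) ∧ (h = 0 ↔ a = y)) =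
          if g = i then {y} else ∅ := by
        ext a
        split_ifs with hi
        · subst hi; simp only [hh, Finset.mem_filter, Finset.mem_univ, true_and, true_iff,
            Finset.mem_singleton]
          exact ⟨fun H => H.2, fun H => ⟨by rw [H]; exact hxy, H⟩⟩
        · simp only [hh, Finset.mem_filter, Finset.mem_univ, true_and, true_iff,
            Finset.notMem_empty, iff_false, not_and]
          rintro H rfl
          have : g = 0 ↔ i = 0 := H.trans hxy.symm
          omega
      rw [e, trivialP, if_neg hg, if_pos hh]
      split_ifs <;> simp
    · have e : (Finset.univ.filter fun a : U => (g = 0 ↔ x = a) ∧ (h = 0 ↔ a = y)) =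
          Finset.univ \ {x, y} := by
        ext a
        simp only [hg, hh, Finset.mem_filter, Finset.mem_univ, true_and, false_iff,
          Finset.mem_sdiff, Finset.mem_insert, Finset.mem_singleton, not_or]
        exact ⟨fun H => ⟨fun h' => H.1 h'.symm, H.2⟩, fun H => ⟨fun h' => H.1 h'.symm, H.2⟩⟩
      rw [e, Finset.card_sdiff_of_subset (Finset.subset_univ _), trivialP, if_neg hg, if_neg hh,
        Nat.card_eq_fintype_card, Finset.card_univ]
      by_cases hi : i = 0
      · obtain rfl := hxy.1 hi
        simp [hi]
      · rw [if_neg hi, Finset.card_pair (fun h' => hi (hxy.2 h'))]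

/-- The trivial scheme on a finite set with more than one element: `R_0` is equality and `R_1` is
inequality. -/
def trivial (U : Type*) [Finite U] (hU : 1 < Nat.card U) : AssociationScheme U (Fin 2) where
  rel g x y := g = 0 ↔ x = y
  existsUnique_rel x y := by
    by_cases h : x = y
    · exact ⟨0, by simp [h], fun g hg => by simpa [h] using hg⟩
    · refine ⟨1, by simp [h], fun g hg => ?_⟩
      have : ¬ g = 0 := by simpa [h] using hg
      omega
  rel_nonempty g := by
    obtain ⟨x, y, hxy⟩ := (Finite.one_lt_card_iff_nontrivial.1 hU).exists_pair_ne
    by_cases h : g = 0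
    · exact ⟨x, x, by simp [h]⟩
    · exact ⟨x, y, by simp [h, hxy]⟩
  zero := 0
  rel_zero x y := by simp
  star := id
  rel_star g x y := by simp [eq_comm]
  p := trivialP U
  card_rel g h i x y hxy := trivial_card U g h i x y hxy

/-- The direct product of schemes. -/
def directProduct {n : ℕ} {X E : Fin n → Type*} [∀ i, Finite (X i)] [∀ i, Finite (E i)]
    (S : ∀ i, AssociationScheme (X i) (E i)) :
    AssociationScheme (∀ i, X i) (∀ i, E i) where
  rel g x y := ∀ i, (S i).rel (g i) (x i) (y i)
  existsUnique_rel x y := by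
    choose g hg hg' using fun i => (S i).existsUnique_rel (x i) (y i)
    exact ⟨g, hg, fun g' h => funext fun i => hg' i _ (h i)⟩
  rel_nonempty g := by
    choose x y hxy using fun i => (S i).rel_nonempty (g i)
    exact ⟨x, y, hxy⟩
  zero i := (S i).zero
  rel_zero x y := by
    simp only [(S _).rel_zero]
    exact funext_iff.symm
  star g i := (S i).star (g i)
  rel_star g x y := by simp only [(S _).rel_star]
  p g h k := ∏ i, (S i).p (g i) (h i) (k i)
  card_rel g h k x y hxy := by
    rw [← Finset.prod_congr rfl fun i _ => (S i).card_rel (g i) (h i) (k i) (x i) (y i) (hxy i),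
      ← Nat.card_pi]
    exact Nat.card_congr
      { toFun := fun a i => ⟨a.1 i, a.2.1 i, a.2.2 i⟩
        invFun := fun a => ⟨fun i => (a i).1, fun i => (a i).2.1, fun i => (a i).2.2⟩
        left_inv := fun _ => rfl
        right_inv := fun _ => rfl }

/-- The factorial scheme of the trivial schemes on `U 0, …, U (n - 1)`. -/
def factorial {n : ℕ} (U : Fin n → Type*) [∀ i, Finite (U i)] (hU : ∀ i, 1 < Nat.card (U i)) :
    AssociationScheme (∀ i, U i) (Fin n → Fin 2) :=
  directProduct fun i => trivial (U i) (hU i)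

/-! ### Terwilliger algebras -/

section Terwilliger

variable (F : Type*) [Field F] {X E : Type*} [Fintype X] [DecidableEq X] [Finite E]
  (S : AssociationScheme X E)

open Classical in
/-- The adjacency matrix `A_g`. -/
def adjMatrix (g : E) : Matrix X X F := Matrix.of fun x y => if S.rel g x y then 1 else 0

open Classical in
/-- The dual idempotent `E_g^*(x)`. -/
def dualIdempotent (x : X) (g : E) : Matrix X X F :=
  Matrix.diagonal fun y => if S.rel g x y then 1 else 0

/-- The Terwilliger `F`-algebra `T(x)` of `S` with respect to `x`. -/
def terwilliger (x : X) : Subalgebra F (Matrix X X F) :=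
  Algebra.adjoin F (Set.range (S.adjMatrix F) ∪ Set.range (S.dualIdempotent F x))

/-- `A_g` as an element of `T(x)`. -/
def adjT (x : X) (g : E) : S.terwilliger F x :=
  ⟨S.adjMatrix F g, Algebra.subset_adjoin (Or.inl ⟨g, rfl⟩)⟩

/-- `E_g^*(x)` as an element of `T(x)`. -/
def dualT (x : X) (g : E) : S.terwilliger F x :=
  ⟨S.dualIdempotent F x g, Algebra.subset_adjoin (Or.inr ⟨g, rfl⟩)⟩

theorem transpose_mem_terwilliger (x : X) {M : Matrix X X F} (hM : M ∈ S.terwilliger F x) :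
    M.transpose ∈ S.terwilliger F x := by
  induction hM using Algebra.adjoin_induction with
  | mem M h =>
    rcases h with ⟨g, rfl⟩ | ⟨g, rfl⟩
    · refine Algebra.subset_adjoin (Or.inl ⟨S.star g, ?_⟩)
      ext a b
      have e : S.rel (S.star g) a b ↔ S.rel g b a := S.rel_star g a b
      by_cases hr : S.rel g b a <;> simp [adjMatrix, e, hr]
    · rw [dualIdempotent, Matrix.diagonal_transpose]
      exact Algebra.subset_adjoin (Or.inr ⟨g, rfl⟩)
  | algebraMap r =>
    rw [Matrix.algebraMap_eq_diagonal, Matrix.diagonal_transpose, ← Matrix.algebraMap_eq_diagonal]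
    exact Subalgebra.algebraMap_mem _ r
  | add a b _ _ ha hb => rw [Matrix.transpose_add]; exact add_mem ha hb
  | mul a b _ _ ha hb => rw [Matrix.transpose_mul]; exact mul_mem hb ha

/-- The algebra anti-homomorphism `M ↦ Mᵀ` of `T(x)`. -/
def transposeT (x : X) : S.terwilliger F x →ₐ[F] (S.terwilliger F x)ᵐᵒᵖ where
  toFun M := MulOpposite.op ⟨M.1.transpose, S.transpose_mem_terwilliger F x M.2⟩
  map_one' := MulOpposite.unop_injective (Subtype.ext Matrix.transpose_one)
  map_mul' M N := MulOpposite.unop_injective (Subtype.ext (Matrix.transpose_mul M.1 N.1))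
  map_zero' := MulOpposite.unop_injective (Subtype.ext Matrix.transpose_zero)
  map_add' M N := MulOpposite.unop_injective (Subtype.ext (Matrix.transpose_add M.1 N.1))
  commutes' r := MulOpposite.unop_injective (Subtype.ext (by
    change (algebraMap F (Matrix X X F) r).transpose = algebraMap F (Matrix X X F) r
    rw [Matrix.algebraMap_eq_diagonal, Matrix.diagonal_transpose]))

end Terwilliger

end AssociationScheme

/-! ### Absolutely irreducible and self-contragredient modules -/

section Modules

variable (F : Type v) [Field F] {A : Type*} [Ring A] [Algebra F A]

/-- The action of `L ⊗ A` on `L ⊗ M` given by `(l ⊗ a) • (k ⊗ m) = l k ⊗ a m`. -/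
abbrev extendedModule (A : Type*) [Ring A] [Algebra F A] (L : Type*) [Field L] [Algebra F L]
    (M : Type*) [AddCommGroup M] [Module F M] [Module A M] [IsScalarTower F A M] :
    Module (L ⊗[F] A) (L ⊗[F] M) :=
  Module.compHom (L ⊗[F] M)
    (((Module.endTensorEndAlgHom (R := F) (A := L) (M := L) (N := M)).comp
      (Algebra.TensorProduct.map (Algebra.lsmul L L L) (Algebra.lsmul F F M) :
        L ⊗[F] A →ₐ[L] Module.End L L ⊗[F] Module.End F M)) :
      L ⊗[F] A →+* Module.End L (L ⊗[F] M))

theorem extendedModule_tmul (L : Type*) [Field L] [Algebra F L]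
    (M : Type*) [AddCommGroup M] [Module F M] [Module A M] [IsScalarTower F A M]
    (l k : L) (a : A) (m : M) :
    letI := extendedModule F A L M
    (l ⊗ₜ[F] a) • (k ⊗ₜ[F] m) = (l * k) ⊗ₜ[F] (a • m) := rfl

/-- `M` is absolutely irreducible: `L ⊗ M` is an irreducible `L ⊗ A`-module for every extension
field `L` of `F`. -/
def IsAbsolutelyIrreducible (A : Type*) [Ring A] [Algebra F A]
    (M : Type*) [AddCommGroup M] [Module F M] [Module A M] [IsScalarTower F A M] : Prop :=
  ∀ (L : Type (max v w')) [Field L] [Algebra F L],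
    letI := extendedModule F A L M
    IsSimpleModule (L ⊗[F] A) (L ⊗[F] M)

variable {F}

/-- The dual space `Hom_F(M, F)` on which `A` acts through the anti-homomorphism `α`. -/
def Contragredient (_α : A →ₐ[F] Aᵐᵒᵖ) (M : Type*) [AddCommGroup M] [Module F M] :=
  Module.Dual F M

namespace Contragredient

variable (α : A →ₐ[F] Aᵐᵒᵖ) (M : Type*) [AddCommGroup M] [Module F M]

instance : AddCommGroup (Contragredient α M) := inferInstanceAs (AddCommGroup (Module.Dual F M))

/-- `(f • β) m = β (α(f) • m)`. -/
instance [Module A M] [IsScalarTower F A M] : Module A (Contragredient α M) where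
  smul f β := (show Module.Dual F M from β) ∘ₗ Algebra.lsmul F F M (α f).unop
  one_smul β := LinearMap.ext fun m => by
    change (show Module.Dual F M from β) ((α 1).unop • m) = (show Module.Dual F M from β) m
    simp
  mul_smul f g β := LinearMap.ext fun m => by
    change (show Module.Dual F M from β) ((α (f * g)).unop • m) =
      (show Module.Dual F M from β) ((α g).unop • (α f).unop • m)
    simp [mul_smul]
  smul_zero f := LinearMap.ext fun m => rfl
  smul_add f β γ := LinearMap.ext fun m => rfl
  add_smul f g β := LinearMap.ext fun m => by
    change (show Module.Dual F M from β) ((α (f + g)).unop • m) =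
      (show Module.Dual F M from β) ((α f).unop • m) +
      (show Module.Dual F M from β) ((α g).unop • m)
    rw [map_add, MulOpposite.unop_add, add_smul]
    exact map_add (show Module.Dual F M from β) _ _
  zero_smul β := LinearMap.ext fun m => by
    change (show Module.Dual F M from β) ((α 0).unop • m) = 0
    rw [map_zero, MulOpposite.unop_zero, zero_smul]
    exact map_zero (show Module.Dual F M from β)

end Contragredient

/-- `M` is self-contragredient with respect to `α`. -/
def IsSelfContragredient (α : A →ₐ[F] Aᵐᵒᵖ) (M : Type*) [AddCommGroup M] [Module F M]
    [Module A M] [IsScalarTower F A M] : Prop :=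
  Nonempty (Contragredient α M ≃ₗ[A] M)

end Modules

/-! ### The irreducible modules `Irr` of the Terwilliger algebra of a factorial scheme -/

namespace FactorialScheme

open AssociationScheme

variable {n : ℕ}

/-- The set of positions at which the `0`-`1`-tuple `g` is `1`. -/
def supp (g : Fin n → Fin 2) : Finset (Fin n) := Finset.univ.filter fun a => g a = 1

/-- The `0`-`1`-tuple with the given support. -/
def ofSupp (V : Finset (Fin n)) : Fin n → Fin 2 := fun a => if a ∈ V then 1 else 0

/-- `V° = {a ∈ V : |U_a| > 2}`. -/
def circ (U : Fin n → Type u) (V : Finset (Fin n)) : Finset (Fin n) :=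
  open Classical in V.filter fun a => 2 < Nat.card (U a)

/-- The tuple `gi`, with support `(g ∆ i) ∪ (g ∩ i)°`. -/
def tupleMul (U : Fin n → Type u) (g i : Fin n → Fin 2) : Fin n → Fin 2 :=
  ofSupp (supp g ∆ supp i ∪ circ U (supp g ∩ supp i))

/-- The set `P` of triples `(a, b, c)` with `a ∆ c ⊆ b ⊆ (a ∆ c) ∪ (a ∩ c)°`. -/
def setP (U : Fin n → Type u) :
    Set ((Fin n → Fin 2) × (Fin n → Fin 2) × (Fin n → Fin 2)) :=
  {t | supp t.1 ∆ supp t.2.2 ⊆ supp t.2.1 ∧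
    supp t.2.1 ⊆ supp t.1 ∆ supp t.2.2 ∪ circ U (supp t.1 ∩ supp t.2.2)}

variable (F : Type v) [Field F] (U : Fin n → Type u) [∀ i, Fintype (U i)]
  (hU : ∀ i, 1 < Nat.card (U i))

/-- The set `D` of triples `(a, b, c) ∈ P` with `p ∤ k_b`, where `p` is the characteristic of
`F`. -/
def setD : Set ((Fin n → Fin 2) × (Fin n → Fin 2) × (Fin n → Fin 2)) :=
  {t | t ∈ setP U ∧ ¬ ringChar F ∣ (factorial U hU).valency t.2.1}

/-- The relation `(g, h, i) ∼ (j, k, l) ↔ (g ∩ i)° \ h = (j ∩ l)° \ k` on `D`. -/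
def simSetoid : Setoid (setD F U hU) :=
  Setoid.ker fun t => circ U (supp t.1.1 ∩ supp t.1.2.2) \ supp t.1.2.1

/-- The set of equivalence classes of `D` with respect to `∼`; it has `n_∼` elements. -/
abbrev SimClass : Type := Quotient (simSetoid F U hU)

variable {F U hU}

/-- The equivalence class `m`, as a set of triples. -/
def SimClass.toSet (m : SimClass F U hU) :
    Set ((Fin n → Fin 2) × (Fin n → Fin 2) × (Fin n → Fin 2)) :=
  {t | ∃ ht : t ∈ setD F U hU, Quotient.mk (simSetoid F U hU) ⟨t, ht⟩ = m}

/-- `D(m) = {a : (a, b, a) ∈ m for some b}`. -/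
def SimClass.index (m : SimClass F U hU) : Set (Fin n → Fin 2) :=
  {a | ∃ b, (a, b, a) ∈ m.toSet}

variable (F U hU) [∀ i, DecidableEq (U i)] (x : ∀ i, U i)

/-- The Terwilliger `F`-algebra of the factorial scheme with respect to `x`. -/
abbrev T : Subalgebra F (Matrix (∀ i, U i) (∀ i, U i) F) := (factorial U hU).terwilliger F x

/-- `B_{g,h,i} = ∑ E_g^* A_j E_i^*`, the sum running over all `j` with `g ∆ i ⊆ j ⊆ h`. -/
def matB (g h i : Fin n → Fin 2) : T F U hU x :=
  ∑ j with supp g ∆ supp i ⊆ supp j ∧ supp j ⊆ supp h,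
    (factorial U hU).dualT F x g * (factorial U hU).adjT F x j * (factorial U hU).dualT F x i

/-- `n_{g,h}`, the number of `a ∈ g \ h` with `p ∤ |U_a| - 1`. -/
def numN (g h : Fin n → Fin 2) : ℕ :=
  Finset.card {a ∈ supp g \ supp h | ¬ ringChar F ∣ Nat.card (U a) - 1}

/-- `U_{g,h,i}`, the set of all `a` with `h ⊆ a ⊆ g`, `p ∤ k_a` and `|a \ h| = i`. -/
def setU (g h : Fin n → Fin 2) (i : ℕ) : Finset (Fin n → Fin 2) :=
  open Classical in
  {a | supp h ⊆ supp a ∧ supp a ⊆ supp g ∧ ¬ ringChar F ∣ (factorial U hU).valency a ∧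
    (supp a \ supp h).card = i}

/-- `D_{g,h,i} = ∑_k ∑_l (-1)^k (k_{i ∩ l})⁻¹ B_{g,l,i}`, the sums running over all
`0 ≤ k ≤ n_{gi,h}` and all `l ∈ U_{gi,h,k}`. -/
def matD (g h i : Fin n → Fin 2) : T F U hU x :=
  ∑ k ∈ Finset.range (numN F U (tupleMul U g i) h + 1),
    ∑ l ∈ setU F U hU (tupleMul U g i) h k,
      ((-1 : F) ^ k *
        ((factorial U hU).valency (ofSupp (supp i ∩ supp l)) : F)⁻¹) • matB F U hU x g l i

variable {F U hU}

/-- The elements `D_{a,h}(m)`, `a ∈ D(m)`, of `T / Rad T`: the residue classes of the matrices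
`D_{a,b,h}` with `a ∈ D(m)` and `(a, b, h) ∈ m` (there is one such `b` for each `a`). -/
def irrGenerators (m : SimClass F U hU) (h : Fin n → Fin 2) :
    Set (T F U hU x ⧸ Ring.jacobson (T F U hU x)) :=
  {v | ∃ a b, a ∈ m.index ∧ (a, b, h) ∈ m.toSet ∧
    v = Ideal.Quotient.mk (Ring.jacobson (T F U hU x)) (matD F U hU x a b h)}

/-- The module `Irr(m)`, realized as the `T`-submodule of `T / Rad T` generated by the elements
`D_{a,h}(m)`, `a ∈ D(m)`, for a chosen `h ∈ D(m)`. -/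
def Irr (m : SimClass F U hU) (h : Fin n → Fin 2) :
    Submodule (T F U hU x) (T F U hU x ⧸ Ring.jacobson (T F U hU x)) :=
  Submodule.span (T F U hU x) (irrGenerators x m h)

end FactorialScheme

end

/-!
The Terwilliger algebra `T` of a factorial scheme is the tensor product of the Terwilliger algebras
of its factors, the trivial schemes on the sets `U t`: every matrix in sight is a combination of
tensor products `piMatrix m`, and `T` is generated by the images under `coord t` of the all-ones
matrix `J` and of the two dual idempotents `E_0^*`, `E_1^*` of each factor (`eq_top_of_coord_mem`).

A single factor is understood through its blocks `E_i^* J E_j^*`. Let `k = |U t| - 1`. If `k` is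
nonzero in `F`, then the `k_j⁻¹ E_i^* J E_j^*` (`cross i j`) are `2 × 2` matrix units, and
`E_1^* - k⁻¹ E_1^* J E_1^*` (`perp`) is an idempotent orthogonal to them, which vanishes if and only
if `|U t| = 2`. If `k` vanishes in `F`, then the three blocks other than `E_0^*` lie in the radical
(`block_mem_jacobson`), and what remains of the factor modulo its radical are the idempotents
`E_0^*` and `E_1^*`, that is, `cross 0 0` and `perp`.

Choosing `perp` on a set `S` of factors with more than two points and some `cross a b` on the other
factors, one gets families of matrix units of `T`, one family for each `S`; modulo the radical they
form a basis of `T` (`matrixUnits`). So `T` modulo its radical is a product of full matrix algebras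
over `F`, indexed by the sets `S`. The simple modules of an algebra with this property
(`MatrixUnits`) are the columns of its matrix units, they are absolutely simple, and they are
self-contragredient for every involution that fixes the diagonal matrix units.

It remains to see that `D_{g,h,i}` is the matrix unit of type `S = (g ∩ i)° \ h` at position
`(g, i)` (`matD_eq_unitT`): the sums in its definition split into sums over the factors. Since `∼`
compares exactly the types `S`, the equivalence classes correspond to the families of matrix units.
-/

noncomputable section

/-! ### Matrix units modulo the Jacobson radical -/

/-- Families of matrix units `e k a b` in the `F`-algebra `A`, one family for each `k : κ`, with `a`
and `b` running over the elements of `ι` with `Valid k`. Different families are orthogonal, `1` is a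
combination of the diagonal matrix units, and modulo the Jacobson radical the columns of each family
span left ideals. So `A` modulo its radical is a product of full matrix algebras over `F`, one for
each nonempty `Valid k`. -/
structure MatrixUnits (F A κ ι : Type*) [Field F] [Ring A] [Algebra F A] where
  Valid : κ → ι → Prop
  e : κ → ι → ι → A
  mul_same : ∀ {k a b d}, Valid k a → Valid k b → Valid k d → e k a b * e k b d = e k a d
  mul_ne : ∀ {k a b k' c d}, Valid k a → Valid k b → Valid k' c → Valid k' d →
    (k ≠ k' ∨ b ≠ c) → e k a b * e k' c d = 0
  one_mem : (1 : A) ∈ Submodule.span F {y | ∃ k a, Valid k a ∧ y = e k a a}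
  ne_zero : ∀ {k a}, Valid k a → e k a a ≠ 0
  mul_mem : ∀ {k a h}, Valid k a → Valid k h → ∀ r : A,
    Ideal.Quotient.mk (Ring.jacobson A) (r * e k a h) ∈
      Submodule.span F {y | ∃ b, Valid k b ∧ y = Ideal.Quotient.mk (Ring.jacobson A) (e k b h)}

theorem IsIdempotentElem.eq_zero_of_mem_jacobson {A : Type*} [Ring A] {e : A}
    (he : IsIdempotentElem e) (h : e ∈ Ring.jacobson A) : e = 0 := by
  have htop : Ideal.span {1 - e} = ⊤ := by
    by_contra hne
    obtain ⟨m, hm, hle⟩ := Ideal.exists_le_maximal _ hne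
    refine hm.ne_top ((Ideal.eq_top_iff_one m).2 ?_)
    have h1 : 1 - e ∈ m := hle (Ideal.subset_span rfl)
    simpa using m.add_mem h1 (Ring.jacobson_le_of_isMaximal m h)
  obtain ⟨r, hr⟩ := Ideal.mem_span_singleton'.1 ((Ideal.eq_top_iff_one _).1 htop)
  have h0 : (1 - e) * e = 0 := by rw [sub_mul, one_mul, he.eq, sub_self]
  calc e = r * (1 - e) * e := by rw [hr, one_mul]
    _ = 0 := by rw [mul_assoc, h0, mul_zero]

theorem IsSimpleModule.smul_eq_zero_of_mem_jacobson {A M : Type*} [Ring A] [AddCommGroup M]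
    [Module A M] [IsSimpleModule A M] {r : A} (h : r ∈ Ring.jacobson A) (m : M) : r • m = 0 := by
  have := Module.le_comap_jacobson (LinearMap.toSpanSingleton A M m) h
  rwa [IsSemisimpleModule.jacobson_eq_bot, Submodule.mem_comap, Submodule.mem_bot] at this

namespace MatrixUnits

variable {F : Type v} {A κ ι : Type*} [Field F] [Ring A] [Algebra F A] (E : MatrixUnits F A κ ι)

/-- The residue class of `e k a h` modulo the radical. -/
abbrev res (k : κ) (a h : ι) : A ⧸ Ring.jacobson A := Ideal.Quotient.mk _ (E.e k a h)

/-- The residue classes of the `h`-th column of the `k`-th family. -/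
def column (k : κ) (h : ι) : Set (A ⧸ Ring.jacobson A) := {y | ∃ b, E.Valid k b ∧ y = E.res k b h}

/-- The left module spanned by the `h`-th column of the `k`-th family modulo the radical. -/
def irr (k : κ) (h : ι) : Submodule A (A ⧸ Ring.jacobson A) := Submodule.span A (E.column k h)

variable {E} {k k' : κ} {a b h h' : ι}

theorem smul_res (r : A) : r • E.res k a h = Ideal.Quotient.mk (Ring.jacobson A) (r * E.e k a h) :=
  rfl

theorem restrictScalars_irr (hh : E.Valid k h) :
    (E.irr k h).restrictScalars F = Submodule.span F (E.column k h) := by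
  refine le_antisymm ?_ (Submodule.span_le.2 fun y hy => Submodule.subset_span hy)
  let P : Submodule A (A ⧸ Ring.jacobson A) :=
    { (Submodule.span F (E.column k h)).toAddSubmonoid with
      smul_mem' := fun r p hp => by
        change r • p ∈ Submodule.span F (E.column k h)
        induction hp using Submodule.span_induction with
        | mem y hy =>
          obtain ⟨b, hb, rfl⟩ := hy
          exact E.mul_mem hb hh r
        | zero => rw [smul_zero]; exact zero_mem _
        | add y z _ _ hy hz => rw [smul_add]; exact add_mem hy hz
        | smul c y _ hy => rw [smul_comm]; exact Submodule.smul_mem _ c hy }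
  have : E.irr k h ≤ P := Submodule.span_le.2 fun y hy =>
    (Submodule.subset_span hy : y ∈ Submodule.span F (E.column k h))
  exact fun y hy => this hy

theorem res_mem_irr (ha : E.Valid k a) : E.res k a h ∈ E.irr k h :=
  Submodule.subset_span ⟨a, ha, rfl⟩

theorem res_ne_zero (hh : E.Valid k h) : E.res k h h ≠ 0 := fun h0 =>
  E.ne_zero hh (IsIdempotentElem.eq_zero_of_mem_jacobson (E.mul_same hh hh hh)
    (Ideal.Quotient.eq_zero_iff_mem.1 h0))

theorem e_smul_mem_span (hh : E.Valid k h) (ha : E.Valid k a) {y : A ⧸ Ring.jacobson A}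
    (hy : y ∈ E.irr k h) : ∃ c : F, E.e k h a • y = c • E.res k h h := by
  have hy' : y ∈ Submodule.span F (E.column k h) := restrictScalars_irr hh ▸ hy
  clear hy
  induction hy' using Submodule.span_induction with
  | mem y hy =>
    obtain ⟨b, hb, rfl⟩ := hy
    by_cases hab : a = b
    · subst hab
      exact ⟨1, by rw [smul_res, E.mul_same hh ha hh, one_smul]⟩
    · exact ⟨0, by rw [smul_res, E.mul_ne hh ha hb hh (Or.inr hab), map_zero, zero_smul]⟩
  | zero => exact ⟨0, by simp⟩
  | add y z _ _ hy hz =>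
    obtain ⟨c, hc⟩ := hy
    obtain ⟨d, hd⟩ := hz
    exact ⟨c + d, by rw [smul_add, hc, hd, add_smul]⟩
  | smul c y _ hy =>
    obtain ⟨d, hd⟩ := hy
    exact ⟨c * d, by rw [smul_comm, hd, mul_smul]⟩

open Classical in
/-- On the simple module of type `k`, the `k`-th family is a complete system of matrix units. -/
theorem sum_e_smul [Fintype ι] (hh : E.Valid k h) {y : A ⧸ Ring.jacobson A}
    (hy : y ∈ E.irr k h) : ∑ a with E.Valid k a, E.e k a a • y = y := by
  have hy' : y ∈ Submodule.span F (E.column k h) := restrictScalars_irr hh ▸ hy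
  clear hy
  induction hy' using Submodule.span_induction with
  | mem y hy =>
    obtain ⟨b, hb, rfl⟩ := hy
    rw [Finset.sum_eq_single_of_mem b (by simpa using hb), smul_res, E.mul_same hb hb hh]
    intro a ha hab
    rw [smul_res, E.mul_ne (by simpa using ha) (by simpa using ha) hb hh (Or.inr hab), map_zero]
  | zero => simp
  | add y z _ _ hy hz => simp only [smul_add, Finset.sum_add_distrib, hy, hz]
  | smul c y _ hy => simp only [smul_comm _ c, ← Finset.smul_sum, hy]

theorem isSimpleModule_irr [Fintype ι] (hh : E.Valid k h) : IsSimpleModule A (E.irr k h) := by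
  classical
  rw [isSimpleModule_iff_toSpanSingleton_surjective]
  have hres : (⟨E.res k h h, res_mem_irr hh⟩ : E.irr k h) ≠ 0 := fun h0 =>
    res_ne_zero hh (congrArg Subtype.val h0)
  refine ⟨⟨_, _, hres⟩, ?_⟩
  rintro ⟨y, hy⟩ hy0
  -- since `y` is the sum of the `e k a h • e k h a • y`, one of the `e k h a • y` is not zero; it
  -- is a multiple of the generator `res k h h`
  have hex : ∃ a, E.Valid k a ∧ E.e k h a • y ≠ 0 := by
    by_contra! hall
    refine hy0 (Subtype.ext ?_)
    refine (sum_e_smul hh hy).symm.trans ?_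
    refine Finset.sum_eq_zero fun a ha => ?_
    have ha : E.Valid k a := by simpa using ha
    rw [← E.mul_same ha hh ha, mul_smul, hall a ha, smul_zero]
  obtain ⟨a, ha, hne⟩ := hex
  obtain ⟨c, hc⟩ := e_smul_mem_span hh ha hy
  have hc0 : c ≠ 0 := by rintro rfl; exact hne (by rw [hc, zero_smul])
  rintro ⟨z, hz⟩
  suffices hle : E.irr k h ≤ LinearMap.range (LinearMap.toSpanSingleton A _ y) by
    obtain ⟨r, hr⟩ := hle hz
    exact ⟨r, Subtype.ext hr⟩
  refine Submodule.span_le.2 ?_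
  rintro _ ⟨b, hb, rfl⟩
  refine ⟨algebraMap F A c⁻¹ * E.e k b h * E.e k h a, ?_⟩
  rw [LinearMap.toSpanSingleton_apply, mul_smul, hc, smul_comm, mul_smul, smul_res,
    E.mul_same hb hh hh, algebraMap_smul, smul_smul, mul_inv_cancel₀ hc0, one_smul]

section Simple

variable {M : Type*} [AddCommGroup M] [Module A M] [IsSimpleModule A M]

variable (E) in
theorem exists_e_smul_ne_zero [Module F M] [IsScalarTower F A M] :
    ∃ k a, E.Valid k a ∧ ∃ m : M, E.e k a a • m ≠ 0 := by
  by_contra! hall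
  have := IsSimpleModule.nontrivial A M
  obtain ⟨m, hm⟩ := exists_ne (0 : M)
  refine hm ?_
  rw [← one_smul A m]
  refine Submodule.span_induction (p := fun r _ => r • m = 0) ?_ (zero_smul A m) ?_ ?_ E.one_mem
  · rintro _ ⟨k, a, ha, rfl⟩
    exact hall k a ha m
  · intro r s _ _ hr hs
    rw [add_smul, hr, hs, add_zero]
  · intro c r _ hr
    rw [smul_assoc, hr, smul_zero]

omit [IsSimpleModule A M] in
theorem e_smul_ne_zero_of_valid (hh : E.Valid k h) (hh' : E.Valid k h') {m : M}
    (hm : E.e k h h • m ≠ 0) : ∃ m' : M, E.e k h' h' • m' ≠ 0 := by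
  refine ⟨E.e k h' h • m, fun h0 => hm ?_⟩
  rw [← mul_smul, E.mul_same hh' hh' hh] at h0
  rw [← E.mul_same hh hh' hh, mul_smul, h0, smul_zero]

/-- A simple module on which the idempotent `e k h h` does not vanish is isomorphic to `irr k h`:
multiplication by a suitable vector is a nonzero homomorphism between simple modules. -/
theorem nonempty_equiv_irr [Fintype ι] (hh : E.Valid k h) {m : M} (hm : E.e k h h • m ≠ 0) :
    Nonempty (M ≃ₗ[A] E.irr k h) := by
  have := isSimpleModule_irr hh
  let f : (A ⧸ Ring.jacobson A) →ₗ[A] M := Submodule.liftQ _ (LinearMap.toSpanSingleton A M m)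
    fun r hr => IsSimpleModule.smul_eq_zero_of_mem_jacobson hr m
  let g : E.irr k h →ₗ[A] M := f ∘ₗ (E.irr k h).subtype
  have hg : g ≠ 0 := fun h0 => hm (LinearMap.congr_fun h0 ⟨E.res k h h, res_mem_irr hh⟩)
  exact ⟨(LinearEquiv.ofBijective g (LinearMap.bijective_of_ne_zero hg)).symm⟩

end Simple

/-- Up to isomorphism, `irr k h` does not depend on the column `h`. -/
theorem nonempty_equiv_irr_of_valid [Fintype ι] (hh : E.Valid k h) (hh' : E.Valid k h') :
    Nonempty (E.irr k h ≃ₗ[A] E.irr k h') := by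
  have := isSimpleModule_irr hh
  have hne : E.e k h h • (⟨E.res k h h, res_mem_irr hh⟩ : E.irr k h) ≠ 0 := by
    intro h0
    have h1 : E.e k h h • E.res k h h = 0 := congrArg Subtype.val h0
    rw [smul_res, E.mul_same hh hh hh] at h1
    exact res_ne_zero hh h1
  obtain ⟨m, hm⟩ := e_smul_ne_zero_of_valid (M := E.irr k h) hh hh' hne
  exact nonempty_equiv_irr hh' hm

theorem eq_of_equiv_irr (hh : E.Valid k h) (hh' : E.Valid k' h')
    (f : E.irr k h ≃ₗ[A] E.irr k' h') : k = k' := by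
  by_contra hne
  refine res_ne_zero hh (congrArg Subtype.val (f.injective ?_ :
    (⟨E.res k h h, res_mem_irr hh⟩ : E.irr k h) = 0))
  rw [map_zero]
  have h1 : (⟨E.res k h h, res_mem_irr hh⟩ : E.irr k h) =
      E.e k h h • ⟨E.res k h h, res_mem_irr hh⟩ := by
    refine Subtype.ext ?_
    change _ = E.e k h h • E.res k h h
    rw [smul_res, E.mul_same hh hh hh]
  rw [h1, map_smul]
  obtain ⟨z, hz⟩ := f ⟨E.res k h h, res_mem_irr hh⟩
  refine Subtype.ext ?_
  change E.e k h h • z = 0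
  have hz' : z ∈ Submodule.span F (E.column k' h') := restrictScalars_irr hh' ▸ hz
  clear hz h1
  induction hz' using Submodule.span_induction with
  | mem y hy =>
    obtain ⟨b, hb, rfl⟩ := hy
    rw [smul_res, E.mul_ne hh hh hb hh' (Or.inl hne), map_zero]
  | zero => rw [smul_zero]
  | add y z _ _ hy hz => rw [smul_add, hy, hz, add_zero]
  | smul c y _ hy => rw [smul_comm, hy, smul_zero]

variable (E) in
/-- For every simple module `M` there is a family of matrix units that is complete on `M`, and a
nonzero vector `m` such that the units in a row `h` of this family map `M` into the line of `m`. -/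
theorem exists_generator [Fintype ι] (M : Type*) [AddCommGroup M] [Module F M] [Module A M]
    [IsScalarTower F A M] [IsSimpleModule A M] : open Classical in
    ∃ k h, E.Valid k h ∧ ∃ m : M, m ≠ 0 ∧
      (∀ a, E.Valid k a → ∀ y : M, ∃ c : F, E.e k h a • y = c • m) ∧
      ∀ y : M, ∑ a with E.Valid k a, E.e k a a • y = y := by
  classical
  obtain ⟨k, h, hh, m, hm⟩ := E.exists_e_smul_ne_zero (M := M)
  obtain ⟨f⟩ := nonempty_equiv_irr hh hm
  refine ⟨k, h, hh, f.symm ⟨E.res k h h, res_mem_irr hh⟩, ?_, ?_, ?_⟩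
  · intro h0
    exact res_ne_zero hh (congrArg Subtype.val (f.symm.injective (h0.trans (map_zero _).symm)))
  · intro a ha y
    obtain ⟨c, hc⟩ := e_smul_mem_span hh ha (f y).2
    refine ⟨c, f.injective (Subtype.ext ?_)⟩
    rw [map_smul, ← algebraMap_smul A c, map_smul, LinearEquiv.apply_symm_apply, algebraMap_smul]
    exact hc
  · intro y
    refine f.injective (Subtype.ext ?_)
    rw [map_sum]
    simp only [map_smul]
    rw [AddSubmonoidClass.coe_finsetSum]
    exact sum_e_smul hh (f y).2

/-- Simple modules are absolutely simple, since the argument for the simplicity of `irr k h` goes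
through over every extension field: the matrix units move any nonzero vector to a nonzero multiple
of a generator. -/
theorem isAbsolutelyIrreducible [Fintype ι] (E : MatrixUnits F A κ ι) (M : Type*)
    [AddCommGroup M] [Module F M] [Module A M] [IsScalarTower F A M] [IsSimpleModule A M] :
    IsAbsolutelyIrreducible.{v, w'} F A M := by
  classical
  intro L _ _
  let _ := extendedModule F A L M
  obtain ⟨k, h, hh, m, hm, hline, hsum⟩ := E.exists_generator M
  have hm1 : (1 : L) ⊗ₜ[F] m ≠ 0 := by
    intro h0
    exact hm (Module.FaithfullyFlat.tensorProduct_mk_injective (A := F) (B := L) M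
      (h0.trans (TensorProduct.tmul_zero _ _).symm))
  rw [isSimpleModule_iff_toSpanSingleton_surjective]
  refine ⟨⟨_, _, hm1⟩, fun y hy => ?_⟩
  have hline' : ∀ a, E.Valid k a → ∀ y : L ⊗[F] M, ∃ l : L,
      ((1 : L) ⊗ₜ[F] E.e k h a) • y = l ⊗ₜ[F] m := by
    intro a ha y
    induction y using TensorProduct.induction_on with
    | zero => exact ⟨0, by rw [smul_zero, TensorProduct.zero_tmul]⟩
    | tmul l y =>
      obtain ⟨c, hc⟩ := hline a ha y
      refine ⟨c • l, ?_⟩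
      rw [extendedModule_tmul, hc, one_mul, TensorProduct.tmul_smul, TensorProduct.smul_tmul']
    | add y z hy hz =>
      obtain ⟨c, hc⟩ := hy
      obtain ⟨d, hd⟩ := hz
      exact ⟨c + d, by rw [smul_add, hc, hd, TensorProduct.add_tmul]⟩
  have hsum' : ∀ y : L ⊗[F] M, ∑ a with E.Valid k a, ((1 : L) ⊗ₜ[F] E.e k a a) • y = y := by
    intro y
    induction y using TensorProduct.induction_on with
    | zero => simp
    | tmul l y =>
      simp only [extendedModule_tmul, one_mul]
      rw [← TensorProduct.tmul_sum, hsum]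
    | add y z hy hz => simp only [smul_add, Finset.sum_add_distrib, hy, hz]
  have hex : ∃ a, E.Valid k a ∧ ((1 : L) ⊗ₜ[F] E.e k h a) • y ≠ 0 := by
    by_contra! hall
    refine hy ?_
    rw [← hsum' y]
    refine Finset.sum_eq_zero fun a ha => ?_
    have ha : E.Valid k a := by simpa using ha
    have : (1 : L) ⊗ₜ[F] E.e k a a = ((1 : L) ⊗ₜ[F] E.e k a h) * ((1 : L) ⊗ₜ[F] E.e k h a) := by
      rw [Algebra.TensorProduct.tmul_mul_tmul, one_mul, E.mul_same ha hh ha]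
    rw [this, mul_smul, hall a ha, smul_zero]
  obtain ⟨a, ha, hne⟩ := hex
  obtain ⟨l, hl⟩ := hline' a ha y
  have hl0 : l ≠ 0 := by rintro rfl; exact hne (by rw [hl, TensorProduct.zero_tmul])
  intro z
  induction z using TensorProduct.induction_on with
  | zero => exact ⟨0, map_zero _⟩
  | tmul t z =>
    obtain ⟨r, hr⟩ := IsSimpleModule.toSpanSingleton_surjective A hm z
    refine ⟨((t * l⁻¹) ⊗ₜ[F] r) * ((1 : L) ⊗ₜ[F] E.e k h a), ?_⟩
    rw [LinearMap.toSpanSingleton_apply, mul_smul, hl, extendedModule_tmul,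
      inv_mul_cancel_right₀ hl0]
    exact congrArg _ hr
  | add y z hy hz =>
    obtain ⟨r, hr⟩ := hy
    obtain ⟨s, hs⟩ := hz
    exact ⟨r + s, by rw [map_add, hr, hs]⟩

end MatrixUnits

/-- The extension field that matters here is `F` itself, lifted to the required universe. -/
theorem IsAbsolutelyIrreducible.isSimpleModule {F : Type v} [Field F] {A : Type*} [Ring A]
    [Algebra F A] {M : Type*} [AddCommGroup M] [Module F M] [Module A M] [IsScalarTower F A M]
    (hM : IsAbsolutelyIrreducible.{v, w'} F A M) : IsSimpleModule A M := by
  let L := ULift.{w'} F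
  let _ := extendedModule F A L M
  have hL : IsSimpleModule (L ⊗[F] A) (L ⊗[F] M) := hM L
  let θ : L ⊗[F] M ≃ₗ[F] M :=
    (TensorProduct.congr (ULift.moduleEquiv (R := F) (M := F)) (LinearEquiv.refl F M)).trans
      (TensorProduct.lid F M)
  have hθ : ∀ (l : L) (m : M), θ (l ⊗ₜ m) = l.down • m := fun l m => by
    simp [θ]
  have hθ' : ∀ (l : L) (r : A) (y : L ⊗[F] M), θ ((l ⊗ₜ[F] r) • y) = l.down • r • θ y := by
    intro l r y
    induction y using TensorProduct.induction_on with
    | zero => simp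
    | tmul k m =>
      rw [extendedModule_tmul, hθ, hθ, ULift.mul_down, mul_smul, smul_comm r]
    | add y z hy hz => rw [smul_add, map_add, hy, hz, map_add, smul_add, smul_add]
  rw [isSimpleModule_iff_toSpanSingleton_surjective]
  have : Nontrivial (L ⊗[F] M) := IsSimpleModule.nontrivial (L ⊗[F] A) _
  refine ⟨θ.symm.toEquiv.nontrivial, fun m hm y => ?_⟩
  have hm' : θ.symm m ≠ 0 := fun h0 => hm (by simpa using h0)
  obtain ⟨r, hr⟩ := IsSimpleModule.toSpanSingleton_surjective (L ⊗[F] A) hm' (θ.symm y)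
  have key : ∀ r : L ⊗[F] A, ∃ s : A, θ (r • θ.symm m) = s • m := by
    intro r
    induction r using TensorProduct.induction_on with
    | zero =>
      exact ⟨0, ((congrArg θ (zero_smul (L ⊗[F] A) _)).trans (map_zero θ)).trans
        (zero_smul A m).symm⟩
    | tmul l r =>
      exact ⟨l.down • r, by rw [hθ', LinearEquiv.apply_symm_apply, smul_assoc]⟩
    | add r s hr hs =>
      obtain ⟨r', hr'⟩ := hr
      obtain ⟨s', hs'⟩ := hs
      exact ⟨r' + s', by rw [add_smul, map_add, hr', hs', add_smul]⟩
  obtain ⟨s, hs⟩ := key r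
  refine ⟨s, ?_⟩
  rw [LinearMap.toSpanSingleton_apply] at hr ⊢
  rw [← hs, hr, LinearEquiv.apply_symm_apply]

section Contragredient

variable {F : Type*} [Field F] {A : Type*} [Ring A] [Algebra F A] (α : A →ₐ[F] Aᵐᵒᵖ)
  {M : Type*} [AddCommGroup M] [Module F M] [Module A M] [IsScalarTower F A M]

theorem Contragredient.smul_apply (f : A) (β : Contragredient α M) (m : M) :
    (show Module.Dual F M from f • β) m = (show Module.Dual F M from β) ((α f).unop • m) := rfl

instance : Module F (Contragredient α M) := inferInstanceAs (Module F (Module.Dual F M))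

instance : IsScalarTower F A (Contragredient α M) where
  smul_assoc c f β := LinearMap.ext fun m => by
    have h1 : (α (c • f)).unop • m = c • ((α f).unop • m) := by
      rw [map_smul, MulOpposite.unop_smul, smul_assoc]
    exact (congrArg (show Module.Dual F M from β) h1).trans
      ((show Module.Dual F M from β).map_smul c _)

/-- The contragredient of a finite-dimensional simple module is simple, since the annihilator in `M`
of a submodule of the dual is a submodule. -/
theorem Contragredient.isSimpleModule (hα : ∀ f, (α (α f).unop).unop = f) [FiniteDimensional F M]
    [IsSimpleModule A M] : IsSimpleModule A (Contragredient α M) := by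
  have := IsSimpleModule.nontrivial A M
  have : Nontrivial (Contragredient α M) := inferInstanceAs (Nontrivial (Module.Dual F M))
  have hor : ∀ W : Submodule A (Contragredient α M), W = ⊥ ∨ W = ⊤ := by
    intro W
    let W' : Submodule F (Module.Dual F M) := W.restrictScalars F
    let N : Submodule A M :=
      { W'.dualCoannihilator with
        smul_mem' := fun r m hm => by
          change r • m ∈ W'.dualCoannihilator
          have hm : m ∈ W'.dualCoannihilator := hm
          rw [Submodule.mem_dualCoannihilator] at hm ⊢
          intro β hβ
          have := hm _ (W.smul_mem (α r).unop hβ)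
          change (show Module.Dual F M from β) ((α (α r).unop).unop • m) = 0 at this
          rwa [hα] at this }
    have hN : N.restrictScalars F = W'.dualCoannihilator := rfl
    have hWW : W'.dualCoannihilator.dualAnnihilator = W' :=
      Subspace.dualCoannihilator_dualAnnihilator_eq
    rcases eq_bot_or_eq_top N with h | h
    · right
      rw [← hN, h] at hWW
      refine Submodule.restrictScalars_injective F A _ ?_
      change W' = ⊤
      rw [← hWW]
      exact Submodule.dualAnnihilator_bot
    · left
      rw [← hN, h] at hWW
      refine Submodule.restrictScalars_injective F A _ ?_
      change W' = ⊥
      rw [← hWW]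
      exact Submodule.dualAnnihilator_top
  exact { eq_bot_or_eq_top := hor }

open MatrixUnits in
/-- If the involution `α` fixes the diagonal matrix units, then one that does not vanish on `M` does
not vanish on its contragredient either, and the two modules have the same type. -/
theorem MatrixUnits.isSelfContragredient {κ ι : Type*} [Fintype ι] (E : MatrixUnits F A κ ι)
    (hα : ∀ f, (α (α f).unop).unop = f) (he : ∀ k a, (α (E.e k a a)).unop = E.e k a a)
    [FiniteDimensional F A] [IsSimpleModule A M] : IsSelfContragredient α M := by
  obtain ⟨k, h, hh, m, hm⟩ := E.exists_e_smul_ne_zero (M := M)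
  have : FiniteDimensional F M := by
    have hm0 : m ≠ 0 := by rintro rfl; exact hm (smul_zero _)
    exact Module.Finite.of_surjective
      ((LinearMap.toSpanSingleton A M m).restrictScalars F)
      (IsSimpleModule.toSpanSingleton_surjective A hm0)
  have := Contragredient.isSimpleModule α (M := M) hα
  obtain ⟨β, hβ⟩ := Module.Projective.exists_dual_ne_zero F hm
  have hβ' : E.e k h h • (show Contragredient α M from β) ≠ 0 := by
    intro h0
    refine hβ ?_
    have h1 := LinearMap.congr_fun (show (show Module.Dual F M from E.e k h h •
      (show Contragredient α M from β)) = 0 from h0) m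
    change β ((α (E.e k h h)).unop • m) = 0 at h1
    rwa [he] at h1
  obtain ⟨f⟩ := nonempty_equiv_irr hh hm
  obtain ⟨g⟩ := nonempty_equiv_irr hh hβ'
  exact ⟨g.trans f.symm⟩

end Contragredient

/-! ### The Terwilliger algebra of a trivial scheme -/

namespace TrivialScheme

variable (F : Type*) [Field F] {W : Type*}

variable (W) in
/-- The valency of `R_v`, as an element of `F`. -/
def val (v : Fin 2) : F := if v = 0 then 1 else ((Nat.card W - 1 : ℕ) : F)

variable (W) in
/-- The all-ones matrix. -/
def allOnes : Matrix W W F := Matrix.of fun _ _ => 1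

variable {F} in
@[simp] theorem val_zero : val F W 0 = 1 := rfl

variable [DecidableEq W] (x : W)

/-- The indicator function of the points `y` with `x R_v y`. -/
def ind (v : Fin 2) : W → F := fun y => if (v = 0 ↔ x = y) then 1 else 0

/-- The dual idempotent `E_v^*`. -/
def dualE (v : Fin 2) : Matrix W W F := Matrix.diagonal (ind F x v)

/-- The block `E_i^* J E_j^*` of the all-ones matrix `J`. -/
def block (i j : Fin 2) : Matrix W W F := Matrix.vecMulVec (ind F x i) (ind F x j)

/-- The multiple `k_j⁻¹ E_i^* J E_j^*` of a block. When no `k_j` vanishes in `F`, these are the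
matrix units of the algebra generated by the `E_i^*` and `J`, modulo its centre. -/
def cross (i j : Fin 2) : Matrix W W F := (val F W j)⁻¹ • block F x i j

/-- `E_1^* - k_1⁻¹ E_1^* J E_1^*`, which is `E_1^*` when `k_1 = 0` in `F`. -/
def perp : Matrix W W F := dualE F x 1 - (val F W 1)⁻¹ • block F x 1 1

variable {F x}

theorem ind_add : ind F x 0 + ind F x 1 = 1 := by
  ext y
  by_cases h : x = y <;> simp [ind, h]

theorem ind_mul (i j : Fin 2) : ind F x i * ind F x j = if i = j then ind F x i else 0 := by
  ext y
  by_cases h : x = y <;> fin_cases i <;> fin_cases j <;> simp [ind, h]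

theorem block_zero_zero : block F x 0 0 = dualE F x 0 := by
  ext y z
  by_cases h : y = z
  · subst h
    by_cases h' : x = y <;> simp [block, dualE, Matrix.vecMulVec_apply, ind, h']
  · rw [dualE, Matrix.diagonal_apply_ne _ h]
    by_cases h' : x = y
    · simp [block, Matrix.vecMulVec_apply, ind, h', h]
    · simp [block, Matrix.vecMulVec_apply, ind, h']

theorem cross_transpose (i : Fin 2) : (cross F x i i).transpose = cross F x i i := by
  rw [cross, Matrix.transpose_smul, block, Matrix.transpose_vecMulVec]

theorem perp_transpose : (perp F x).transpose = perp F x := by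
  rw [perp, Matrix.transpose_sub, Matrix.transpose_smul, dualE, Matrix.diagonal_transpose, block,
    Matrix.transpose_vecMulVec]

variable (x) in
theorem dualE_add : dualE F x 0 + dualE F x 1 = 1 := by
  rw [dualE, dualE, Matrix.diagonal_add, ← Matrix.diagonal_one]
  exact congrArg Matrix.diagonal ind_add

variable (x) in
theorem allOnes_eq :
    allOnes F W = block F x 0 0 + block F x 0 1 + (block F x 1 0 + block F x 1 1) := by
  ext y z
  have hy : ind F x 0 y + ind F x 1 y = 1 := congrFun ind_add y
  have hz : ind F x 0 z + ind F x 1 z = 1 := congrFun ind_add z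
  simp only [allOnes, block, Matrix.of_apply, Matrix.add_apply, Matrix.vecMulVec_apply]
  rw [← mul_add, ← mul_add, hz, mul_one, mul_one, hy]

variable [Fintype W]

theorem sum_ind (i : Fin 2) : ∑ y, ind F x i y = val F W i := by
  fin_cases i
  · simp [ind]
  · have h : ∀ y, ind F x 1 y = 1 - if x = y then 1 else 0 := fun y => by
      by_cases h : x = y <;> simp [ind, h]
    have hc : 1 ≤ Nat.card W := by
      have : Nonempty W := ⟨x⟩
      exact Nat.card_pos
    rw [Nat.card_eq_fintype_card] at hc
    simp [h, val, Nat.cast_sub hc]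

theorem dotProduct_ind (i j : Fin 2) :
    dotProduct (ind F x i) (ind F x j) = if i = j then val F W i else 0 := by
  have h : dotProduct (ind F x i) (ind F x j) = ∑ y, (ind F x i * ind F x j) y := rfl
  rw [h, ind_mul]
  split_ifs
  · exact sum_ind i
  · simp

theorem block_mul_block (i j k l : Fin 2) :
    block F x i j * block F x k l = (if j = k then val F W j else 0) • block F x i l := by
  rw [block, block, Matrix.vecMulVec_mul_vecMulVec, dotProduct_ind]
  ext y z
  simp only [block, Matrix.smul_apply, Matrix.vecMulVec_apply, Pi.smul_apply, smul_eq_mul]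
  ring

theorem dualE_mul_block (v i j : Fin 2) :
    dualE F x v * block F x i j = if v = i then block F x i j else 0 := by
  ext y z
  have h := congrFun (ind_mul (F := F) (x := x) v i) y
  rw [Pi.mul_apply] at h
  rw [dualE, Matrix.diagonal_mul, block, Matrix.vecMulVec_apply, ← mul_assoc, h]
  split_ifs with hv
  · rw [hv, Matrix.vecMulVec_apply]
  · simp

theorem block_mul_dualE (v i j : Fin 2) :
    block F x i j * dualE F x v = if j = v then block F x i j else 0 := by
  ext y z
  have h := congrFun (ind_mul (F := F) (x := x) j v) z
  rw [Pi.mul_apply] at h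
  rw [dualE, Matrix.mul_diagonal, block, Matrix.vecMulVec_apply, mul_assoc, h]
  split_ifs with hv
  · rw [Matrix.vecMulVec_apply]
  · simp

theorem dualE_mul_dualE (v i : Fin 2) :
    dualE F x v * dualE F x i = if v = i then dualE F x v else 0 := by
  rw [dualE, dualE, Matrix.diagonal_mul_diagonal]
  change Matrix.diagonal (ind F x v * ind F x i) = _
  rw [ind_mul]
  split_ifs <;> simp

theorem allOnes_mul_block (i j : Fin 2) :
    allOnes F W * block F x i j = val F W i • (block F x 0 j + block F x 1 j) := by
  rw [allOnes_eq x]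
  fin_cases i <;> simp [add_mul, block_mul_block]

theorem allOnes_mul_dualE (j : Fin 2) :
    allOnes F W * dualE F x j = block F x 0 j + block F x 1 j := by
  rw [allOnes_eq x]
  fin_cases j <;> simp [add_mul, block_mul_dualE]

theorem dualE_mul_allOnes (i : Fin 2) :
    dualE F x i * allOnes F W = block F x i 0 + block F x i 1 := by
  rw [allOnes_eq x]
  fin_cases i <;> simp [mul_add, dualE_mul_block]

theorem dualE_mul_allOnes_mul_dualE (i j : Fin 2) :
    dualE F x i * allOnes F W * dualE F x j = block F x i j := by
  rw [dualE_mul_allOnes]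
  fin_cases j <;> simp [add_mul, block_mul_dualE]

/-- On a set with two points, `E_1^*` is a matrix with a single entry. -/
theorem block_one_one (h : Nat.card W = 2) : block F x 1 1 = dualE F x 1 := by
  ext y z
  by_cases hyz : y = z
  · subst hyz
    by_cases h' : x = y <;> simp [block, dualE, Matrix.vecMulVec_apply, ind, h']
  · rw [dualE, Matrix.diagonal_apply_ne _ hyz]
    by_cases hy : x = y
    · simp [block, Matrix.vecMulVec_apply, ind, hy]
    by_cases hz : x = z
    · simp [block, Matrix.vecMulVec_apply, ind, hz]
    exfalso
    have h3 : ({x, y, z} : Finset W).card = 3 := by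
      rw [Finset.card_eq_three]
      exact ⟨x, y, z, hy, hz, hyz, rfl⟩
    have := Finset.card_le_univ ({x, y, z} : Finset W)
    rw [Nat.card_eq_fintype_card] at h
    omega

theorem cross_mul_cross {i j k l : Fin 2} (hj : val F W j ≠ 0) :
    cross F x i j * cross F x k l = if j = k then cross F x i l else 0 := by
  rw [cross, cross, smul_mul_smul_comm, block_mul_block]
  split_ifs
  · rw [cross, smul_smul, mul_right_comm, inv_mul_cancel₀ hj, one_mul]
  · simp

theorem perp_mul_block (j : Fin 2) {i : Fin 2} (hi : val F W i ≠ 0) :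
    perp F x * block F x i j = 0 := by
  rw [perp, sub_mul, dualE_mul_block, smul_mul_assoc, block_mul_block]
  by_cases h : i = 1
  · subst h
    simp [smul_smul, inv_mul_cancel₀ hi]
  · simp [Ne.symm h]

theorem block_mul_perp (i : Fin 2) {j : Fin 2} (hj : val F W j ≠ 0) :
    block F x i j * perp F x = 0 := by
  rw [perp, mul_sub, block_mul_dualE, mul_smul_comm, block_mul_block]
  by_cases h : j = 1
  · subst h
    simp [smul_smul, inv_mul_cancel₀ hj]
  · simp [h]

theorem perp_mul_cross (j : Fin 2) {i : Fin 2} (hi : val F W i ≠ 0) :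
    perp F x * cross F x i j = 0 := by
  rw [cross, mul_smul_comm, perp_mul_block j hi, smul_zero]

theorem cross_mul_perp (i : Fin 2) {j : Fin 2} (hj : val F W j ≠ 0) :
    cross F x i j * perp F x = 0 := by
  rw [cross, smul_mul_assoc, block_mul_perp i hj, smul_zero]

theorem perp_mul_perp : perp F x * perp F x = perp F x := by
  by_cases h : val F W 1 = 0
  · simp [perp, h, dualE_mul_dualE]
  · nth_rewrite 2 [perp]
    rw [mul_sub, mul_smul_comm, perp_mul_block 1 h, smul_zero, sub_zero, perp, sub_mul,
      dualE_mul_dualE, smul_mul_assoc, block_mul_dualE, if_pos rfl, if_pos rfl]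

theorem perp_eq_zero (h : Nat.card W = 2) : perp F x = 0 := by
  rw [perp, block_one_one h, val, h]
  simp

theorem dualE_mul_cross (v i j : Fin 2) :
    dualE F x v * cross F x i j = if v = i then cross F x i j else 0 := by
  rw [cross, mul_smul_comm, dualE_mul_block, smul_ite, smul_zero]

theorem dualE_mul_perp (v : Fin 2) :
    dualE F x v * perp F x = if v = 1 then perp F x else 0 := by
  rw [perp, mul_sub, mul_smul_comm, dualE_mul_block, dualE_mul_dualE]
  split_ifs with h
  · rw [h]
  · simp

theorem allOnes_mul_cross (i j : Fin 2) :
    allOnes F W * cross F x i j = val F W i • (cross F x 0 j + cross F x 1 j) := by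
  rw [cross, mul_smul_comm, allOnes_mul_block, smul_comm, smul_add, cross, cross]

theorem allOnes_mul_perp (h : val F W 1 ≠ 0) : allOnes F W * perp F x = 0 := by
  rw [perp, mul_sub, mul_smul_comm, allOnes_mul_dualE, allOnes_mul_block, smul_smul,
    inv_mul_cancel₀ h, one_smul, sub_self]

theorem cross_self_ne_zero (hW : 1 < Nat.card W) {i : Fin 2} (hi : val F W i ≠ 0) :
    ∃ y z, cross F x i i y z ≠ 0 := by
  have : Nontrivial W := Finite.one_lt_card_iff_nontrivial.1 hW
  obtain ⟨y, hy⟩ := exists_ne x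
  by_cases h : i = 0
  · exact ⟨x, x, by simp [cross, block, Matrix.vecMulVec_apply, ind, h]⟩
  · exact ⟨y, y, by simp [cross, block, Matrix.vecMulVec_apply, ind, h, hy.symm, hi]⟩

theorem perp_ne_zero (hW : 2 < Nat.card W) : ∃ y z, perp F x y z ≠ 0 := by
  rw [Nat.card_eq_fintype_card, Fintype.two_lt_card_iff] at hW
  have hex : ∃ y z, x ≠ y ∧ x ≠ z ∧ y ≠ z := by
    obtain ⟨a, b, c, hab, hac, hbc⟩ := hW
    by_cases h1 : x = a
    · subst h1; exact ⟨b, c, hab, hac, hbc⟩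
    by_cases h2 : x = b
    · subst h2; exact ⟨a, c, h1, hbc, hac⟩
    exact ⟨a, b, h1, h2, hab⟩
  obtain ⟨y, z, hy, hz, hyz⟩ := hex
  -- the entries at `(y, y)` and at `(y, z)` differ by `1`
  by_contra! h
  have h1 := h y y
  have h2 := h y z
  simp only [perp, dualE, block, Matrix.sub_apply, Matrix.smul_apply, Matrix.vecMulVec_apply,
    Matrix.diagonal_apply_eq, Matrix.diagonal_apply_ne _ hyz] at h1 h2
  simp [ind, hy, hz] at h1 h2
  simp [h2] at h1

theorem sum_dualE_mul_mul_dualE {g i l : Fin 2} (h : g ≠ i → l = 1) :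
    ∑ v : Fin 2 with (g ≠ i → v = 1) ∧ (v = 1 → l = 1),
      dualE F x g * (if v = 0 then 1 else allOnes F W - 1) * dualE F x i =
      if l = 1 then block F x g i else dualE F x g := by
  have h1 : dualE F x g * (allOnes F W - 1) * dualE F x i =
      block F x g i - if g = i then dualE F x g else 0 := by
    rw [mul_sub, sub_mul, dualE_mul_allOnes_mul_dualE, mul_one, dualE_mul_dualE]
  rw [Finset.sum_filter, Fin.sum_univ_two]
  by_cases hgi : g = i
  · subst hgi
    by_cases hl : l = 1
    · simp [hl, h1, dualE_mul_dualE]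
    · simp [hl, dualE_mul_dualE]
  · simp [hgi, h hgi, h1]

/-- The alternating sum that defines `D_{g,h,i}`, on a single factor. -/
theorem sum_sign_smul (hW : 1 < Nat.card W) {g h i : Fin 2}
    (hh : h = 1 → g ≠ i ∨ (g = 1 ∧ i = 1 ∧ 2 < Nat.card W)) (hne : g ≠ i → h = 1)
    (hv : h = 1 → val F W 1 ≠ 0) : open Classical in
    ∑ v with (h = 1 → v = 1) ∧ (v = 1 → g ≠ i ∨ (g = 1 ∧ i = 1 ∧ 2 < Nat.card W)) ∧ val F W v ≠ 0,
      ((if v = 1 ∧ h ≠ 1 then -1 else 1) * (val F W (if i = 1 ∧ v = 1 then 1 else 0))⁻¹ : F) •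
        (if v = 1 then block F x g i else dualE F x g) =
      if (g = 1 ∧ i = 1 ∧ 2 < Nat.card W) ∧ h ≠ 1 then perp F x else cross F x g i := by
  classical
  rw [Finset.sum_filter, Fin.sum_univ_two]
  by_cases h1 : h = 1
  · have h2 : val F W (if i = 1 then 1 else 0) = val F W i := by
      split_ifs with hi
      · rw [hi]
      · rw [show i = 0 by omega]
    simp [h1, hh h1, hv h1, h2, cross, -Nat.card_eq_fintype_card]
  · have hgi : g = i := by
      by_contra hne'
      exact h1 (hne hne')
    subst hgi
    by_cases hg : g = 1
    · subst hg
      by_cases hc : 2 < Nat.card W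
      · by_cases hv1 : val F W 1 = 0
        · simp [h1, hc, hv1, perp, -Nat.card_eq_fintype_card]
        · simp [h1, hc, hv1, perp, sub_eq_add_neg, -Nat.card_eq_fintype_card]
      · have hc2 : Nat.card W = 2 := by omega
        have hv1 : val F W 1 = 1 := by rw [val, hc2]; simp
        simp [h1, hc2, hv1, cross, block_one_one hc2, -Nat.card_eq_fintype_card]
    · have hg : g = 0 := by omega
      subst hg
      simp [h1, cross, block_zero_zero]

end TrivialScheme

/-! ### Tensor products of matrices -/

/-- A form of `Fintype.prod_boole` for an arbitrary decidability instance. -/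
theorem Fintype.prod_ite_one_zero {ι R : Type*} [Fintype ι] [CommMonoidWithZero R] (P : ι → Prop)
    [DecidablePred P] [Decidable (∀ i, P i)] :
    ∏ i, (if P i then (1 : R) else 0) = if ∀ i, P i then 1 else 0 := by
  split_ifs with h
  · exact Finset.prod_eq_one fun i _ => if_pos (h i)
  · obtain ⟨i, hi⟩ := not_forall.1 h
    exact Finset.prod_eq_zero (Finset.mem_univ i) (if_neg hi)

section PiMatrix

variable {n : ℕ} {F : Type*} [Field F] {U : Fin n → Type*}

/-- The tensor product of the matrices `m t`, indexed by the product of the index sets. -/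
def piMatrix (m : ∀ t, Matrix (U t) (U t) F) : Matrix (∀ t, U t) (∀ t, U t) F :=
  Matrix.of fun y z => ∏ t, m t (y t) (z t)

theorem piMatrix_apply (m : ∀ t, Matrix (U t) (U t) F) (y z : ∀ t, U t) :
    piMatrix m y z = ∏ t, m t (y t) (z t) := rfl

theorem prod_smul_piMatrix (c : Fin n → F) (m : ∀ t, Matrix (U t) (U t) F) :
    (∏ t, c t) • piMatrix m = piMatrix fun t => c t • m t := by
  ext y z
  simp [piMatrix_apply, Finset.prod_mul_distrib]

theorem piMatrix_transpose (m : ∀ t, Matrix (U t) (U t) F) :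
    (piMatrix m).transpose = piMatrix fun t => (m t).transpose := rfl

theorem sum_piMatrix {κ : Type*} [Fintype κ] (P : Fin n → κ → Prop) [∀ t, DecidablePred (P t)]
    (f : ∀ t, κ → Matrix (U t) (U t) F) :
    ∑ l : Fin n → κ with ∀ t, P t (l t), piMatrix (fun t => f t (l t)) =
      piMatrix fun t => ∑ v with P t v, f t v := by
  classical
  ext y z
  simp only [piMatrix_apply, Matrix.sum_apply]
  rw [Finset.prod_univ_sum]
  refine Finset.sum_congr ?_ fun _ _ => rfl
  ext l
  simp

theorem piMatrix_update_apply (m : ∀ t, Matrix (U t) (U t) F) (t : Fin n) (N : Matrix (U t) (U t) F)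
    (y z : ∀ t, U t) : piMatrix (Function.update m t N) y z =
      N (y t) (z t) * ∏ s ∈ Finset.univ.erase t, m s (y s) (z s) := by
  rw [piMatrix_apply, ← Finset.mul_prod_erase _ _ (Finset.mem_univ t), Function.update_self]
  refine congrArg _ (Finset.prod_congr rfl fun s hs => ?_)
  rw [Function.update_of_ne (Finset.ne_of_mem_erase hs)]

theorem piMatrix_update_smul (m : ∀ t, Matrix (U t) (U t) F) (t : Fin n) (c : F)
    (N : Matrix (U t) (U t) F) :
    piMatrix (Function.update m t (c • N)) = c • piMatrix (Function.update m t N) := by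
  ext y z
  simp only [piMatrix_update_apply, Matrix.smul_apply, smul_eq_mul, mul_assoc]

theorem piMatrix_update_add (m : ∀ t, Matrix (U t) (U t) F) (t : Fin n)
    (N N' : Matrix (U t) (U t) F) : piMatrix (Function.update m t (N + N')) =
      piMatrix (Function.update m t N) + piMatrix (Function.update m t N') := by
  ext y z
  simp only [piMatrix_update_apply, Matrix.add_apply, add_mul]

theorem piMatrix_ne_zero {m : ∀ t, Matrix (U t) (U t) F} (h : ∀ t, ∃ y z, m t y z ≠ 0) :
    piMatrix m ≠ 0 := by
  choose y z hyz using h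
  intro h0
  have h1 : ∏ t, m t (y t) (z t) = 0 := congrFun (congrFun h0 y) z
  exact Finset.prod_ne_zero_iff.2 (fun t _ => hyz t) h1

theorem piMatrix_eq_zero {m : ∀ t, Matrix (U t) (U t) F} {t : Fin n} (h : m t = 0) :
    piMatrix m = 0 := by
  ext y z
  exact Finset.prod_eq_zero (Finset.mem_univ t) (by rw [h]; rfl)

section

variable [∀ t, Fintype (U t)]

theorem piMatrix_mul (m m' : ∀ t, Matrix (U t) (U t) F) :
    piMatrix m * piMatrix m' = piMatrix (m * m') := by
  ext y z
  simp only [Matrix.mul_apply, piMatrix_apply, ← Finset.prod_mul_distrib, Pi.mul_apply]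
  rw [Finset.prod_univ_sum, Fintype.piFinset_univ]

end

variable [∀ t, DecidableEq (U t)]

theorem piMatrix_one : piMatrix (1 : ∀ t, Matrix (U t) (U t) F) = 1 := by
  ext y z
  rw [piMatrix_apply]
  simp only [Pi.one_apply, Matrix.one_apply]
  rw [Fintype.prod_ite_one_zero]
  exact if_congr funext_iff.symm rfl rfl

theorem piMatrix_mulSingle_one (t : Fin n) :
    piMatrix (Pi.mulSingle t (1 : Matrix (U t) (U t) F)) = 1 := by
  rw [Pi.mulSingle_one, piMatrix_one]

variable [∀ t, Fintype (U t)]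

theorem piMatrix_mulSingle_mul (t : Fin n) (N : Matrix (U t) (U t) F)
    (m : ∀ t, Matrix (U t) (U t) F) :
    piMatrix (Pi.mulSingle t N) * piMatrix m = piMatrix (Function.update m t (N * m t)) := by
  rw [piMatrix_mul]
  congr 1
  funext s
  by_cases h : s = t
  · subst h; simp
  · simp [h]

/-- The embedding of the matrices on `U t` as the matrices that act on the `t`-th factor only. -/
def coord (t : Fin n) : Matrix (U t) (U t) F →ₐ[F] Matrix (∀ t, U t) (∀ t, U t) F :=
  AlgHom.ofLinearMap
    { toFun := fun N => piMatrix (Pi.mulSingle t N)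
      map_add' := piMatrix_update_add _ t
      map_smul' := fun c => piMatrix_update_smul _ t c }
    (piMatrix_mulSingle_one t)
    fun N N' => by
      change piMatrix _ = piMatrix _ * piMatrix _
      rw [piMatrix_mul, Pi.mulSingle_mul]

theorem coord_apply (t : Fin n) (N : Matrix (U t) (U t) F) :
    coord t N = piMatrix (Pi.mulSingle t N) := rfl

theorem coord_commute {s t : Fin n} (h : s ≠ t) (M : Matrix (U s) (U s) F)
    (N : Matrix (U t) (U t) F) : Commute (coord s M) (coord t N) := by
  rw [Commute, SemiconjBy, coord_apply, coord_apply, piMatrix_mul, piMatrix_mul]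
  exact congrArg piMatrix
    (Pi.mulSingle_commute (f := fun t => Matrix (U t) (U t) F) h M N)

theorem coord_mul_piMatrix (t : Fin n) (N : Matrix (U t) (U t) F) (m : ∀ t, Matrix (U t) (U t) F) :
    coord t N * piMatrix m = piMatrix (Function.update m t (N * m t)) := by
  rw [coord_apply, piMatrix_mulSingle_mul]

theorem coord_mul_piMatrix_of_mul_eq_smul {t : Fin n} {N : Matrix (U t) (U t) F}
    {m : ∀ t, Matrix (U t) (U t) F} {c : F} (h : N * m t = c • m t) :
    coord t N * piMatrix m = c • piMatrix m := by
  rw [coord_mul_piMatrix, h, piMatrix_update_smul, Function.update_eq_self]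

/-- The matrix `piMatrix m` is the product of the commuting matrices `coord t (m t)`. -/
theorem piMatrix_mem {B : Submonoid (Matrix (∀ t, U t) (∀ t, U t) F)}
    {m : ∀ t, Matrix (U t) (U t) F} (h : ∀ t, coord t (m t) ∈ B) : piMatrix m ∈ B := by
  let φ : (∀ t, Matrix (U t) (U t) F) →* Matrix (∀ t, U t) (∀ t, U t) F :=
    { toFun := piMatrix
      map_one' := piMatrix_one
      map_mul' := fun a b => (piMatrix_mul a b).symm }
  have hm : φ m ∈ B := by
    rw [← Finset.noncommProd_mulSingle m]
    erw [Finset.map_noncommProd]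
    exact Submonoid.noncommProd_mem _ _ _ _ fun t _ => h t
  exact hm

end PiMatrix

/-! ### The Terwilliger algebra of a factorial scheme -/

namespace FactorialScheme

open AssociationScheme TrivialScheme

variable {F : Type v} [Field F] {n : ℕ} {U : Fin n → Type u} [∀ i, Fintype (U i)]
  (hU : ∀ i, 1 < Nat.card (U i)) [∀ i, DecidableEq (U i)]

theorem adjMatrix_eq (g : Fin n → Fin 2) : (factorial U hU).adjMatrix F g =
    piMatrix fun t => if g t = 0 then 1 else allOnes F (U t) - 1 := by
  ext y z
  have h : (factorial U hU).rel g y z ↔ ∀ t, (g t = 0 ↔ y t = z t) := Iff.rfl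
  classical
  rw [adjMatrix, Matrix.of_apply, piMatrix_apply]
  refine ((if_congr h rfl rfl).trans (Fintype.prod_ite_one_zero _).symm).trans ?_
  refine Finset.prod_congr rfl fun t _ => ?_
  by_cases h0 : g t = 0 <;> by_cases h1 : y t = z t <;>
    simp [h0, h1, allOnes, Matrix.one_apply]

variable {hU} (x : ∀ i, U i)

theorem dualIdempotent_eq (g : Fin n → Fin 2) : (factorial U hU).dualIdempotent F x g =
    piMatrix fun t => dualE F (x t) (g t) := by
  ext y z
  classical
  rw [dualIdempotent, piMatrix_apply]
  by_cases hyz : y = z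
  · subst hyz
    have h : (factorial U hU).rel g x y ↔ ∀ t, (g t = 0 ↔ x t = y t) := Iff.rfl
    rw [Matrix.diagonal_apply_eq]
    refine ((if_congr h rfl rfl).trans (Fintype.prod_ite_one_zero _).symm).trans ?_
    refine Finset.prod_congr rfl fun t _ => ?_
    rw [dualE, Matrix.diagonal_apply_eq, ind]
  · rw [Matrix.diagonal_apply_ne _ hyz]
    obtain ⟨t, ht⟩ := Function.ne_iff.1 hyz
    refine (Finset.prod_eq_zero (Finset.mem_univ t) ?_).symm
    exact Matrix.diagonal_apply_ne _ ht

variable {x}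

theorem coord_dualE_mem (t : Fin n) (v : Fin 2) : coord t (dualE F (x t) v) ∈ T F U hU x := by
  have h : coord t (dualE F (x t) v) = ∑ g : Fin n → Fin 2 with ∀ s, s = t → g s = v,
      (factorial U hU).dualIdempotent F x g := by
    simp only [dualIdempotent_eq]
    rw [sum_piMatrix (fun s w => s = t → w = v) fun s w => dualE F (x s) w, coord_apply]
    congr 1
    funext s
    by_cases hs : s = t
    · subst hs; simp [Finset.filter_eq']
    · simp [hs, dualE_add]
  rw [h]
  exact sum_mem fun g _ => ((factorial U hU).dualT F x g).2

theorem coord_allOnes_mem (t : Fin n) : coord t (allOnes F (U t)) ∈ T F U hU x := by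
  have h : coord t (allOnes F (U t)) = 1 + (factorial U hU).adjMatrix F (Pi.single t 1) := by
    rw [adjMatrix_eq, ← map_one (coord t), ← sub_eq_iff_eq_add', ← map_sub, coord_apply]
    congr 1
    funext s
    by_cases hs : s = t
    · subst hs; simp
    · simp [hs]
  rw [h]
  exact add_mem (one_mem _) ((factorial U hU).adjT F x _).2

theorem coord_block_mem (t : Fin n) (i j : Fin 2) : coord t (block F (x t) i j) ∈ T F U hU x := by
  rw [← dualE_mul_allOnes_mul_dualE, map_mul, map_mul]
  exact mul_mem (mul_mem (coord_dualE_mem t i) (coord_allOnes_mem t)) (coord_dualE_mem t j)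

theorem coord_cross_mem (t : Fin n) (i j : Fin 2) : coord t (cross F (x t) i j) ∈ T F U hU x := by
  rw [cross, map_smul]
  exact Subalgebra.smul_mem _ (coord_block_mem t i j) _

theorem coord_perp_mem (t : Fin n) : coord t (perp F (x t)) ∈ T F U hU x := by
  rw [perp, map_sub, map_smul]
  exact sub_mem (coord_dualE_mem t 1) (Subalgebra.smul_mem _ (coord_block_mem t 1 1) _)

/-- The all-ones matrix on the `t`-th factor, as an element of the Terwilliger algebra. -/
def coordOnes (t : Fin n) : T F U hU x := ⟨coord t (allOnes F (U t)), coord_allOnes_mem t⟩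

/-- The dual idempotent `E_v^*` on the `t`-th factor, as an element of the Terwilliger algebra. -/
def coordDual (t : Fin n) (v : Fin 2) : T F U hU x :=
  ⟨coord t (dualE F (x t) v), coord_dualE_mem t v⟩

/-- The Terwilliger algebra is generated by those of the factors. -/
theorem eq_top_of_coord_mem {B : Subalgebra F (T F U hU x)} (h1 : ∀ t, coordOnes t ∈ B)
    (h2 : ∀ t v, coordDual t v ∈ B) : B = ⊤ := by
  have key : T F U hU x ≤ B.map (T F U hU x).val := by
    have k1 : ∀ t, coord t (allOnes F (U t)) ∈ B.map (T F U hU x).val := fun t => ⟨_, h1 t, rfl⟩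
    have k2 : ∀ t v, coord t (dualE F (x t) v) ∈ B.map (T F U hU x).val :=
      fun t v => ⟨_, h2 t v, rfl⟩
    refine Algebra.adjoin_le ?_
    rintro _ (⟨g, rfl⟩ | ⟨g, rfl⟩)
    · rw [adjMatrix_eq]
      refine piMatrix_mem (B := (B.map (T F U hU x).val).toSubmonoid) fun t => ?_
      change coord t _ ∈ B.map (T F U hU x).val
      split_ifs
      · rw [map_one]; exact one_mem _
      · rw [map_sub, map_one]; exact sub_mem (k1 t) (one_mem _)
    · rw [dualIdempotent_eq]
      exact piMatrix_mem (B := (B.map (T F U hU x).val).toSubmonoid) fun t => k2 t _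
  refine eq_top_iff.2 fun r _ => ?_
  obtain ⟨s, hs, hsr⟩ := key r.2
  rwa [← Subtype.ext hsr]

theorem smul_mem_of_coord_smul_mem {M : Type*} [AddCommGroup M] [Module F M]
    [Module (T F U hU x) M] [IsScalarTower F (T F U hU x) M] {P : Submodule F M}
    (h1 : ∀ t, ∀ m ∈ P, (coordOnes t : T F U hU x) • m ∈ P)
    (h2 : ∀ t v, ∀ m ∈ P, (coordDual t v : T F U hU x) • m ∈ P) (r : T F U hU x) {m : M}
    (hm : m ∈ P) : r • m ∈ P := by
  let B : Subalgebra F (T F U hU x) :=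
    { carrier := {r | ∀ m ∈ P, r • m ∈ P}
      mul_mem' := fun {a b} ha hb m hm => by rw [mul_smul]; exact ha _ (hb m hm)
      add_mem' := fun {a b} ha hb m hm => by rw [add_smul]; exact add_mem (ha m hm) (hb m hm)
      algebraMap_mem' := fun c m hm => by rw [algebraMap_smul]; exact P.smul_mem c hm }
  have hB : B = ⊤ := eq_top_of_coord_mem h1 h2
  exact (hB ▸ Algebra.mem_top : r ∈ B) m hm

/-- If the left ideal generated by a square-zero element `r` of the `t`-th factor is spanned by `r`
modulo the radical, then `r` lies in the radical: for a simple module `M`, the subspace `r M` is a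
submodule, and it is not `M`. -/
theorem coord_mem_jacobson {t : Fin n} {r z : Matrix (U t) (U t) F} {c : F} {d : Fin 2 → F}
    (hr : coord t r ∈ T F U hU x) (hz : coord t z ∈ T F U hU x)
    (hz' : (⟨coord t z, hz⟩ : T F U hU x) ∈ Ring.jacobson (T F U hU x))
    (hJ : allOnes F (U t) * r = c • r + z) (hE : ∀ v, dualE F (x t) v * r = d v • r)
    (hrr : r * r = 0) : (⟨coord t r, hr⟩ : T F U hU x) ∈ Ring.jacobson (T F U hU x) := by
  rw [Ring.jacobson_eq_sInf_isMaximal, Submodule.mem_sInf]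
  intro I hI
  have hI : Ideal.IsMaximal I := hI
  have : IsSimpleModule (T F U hU x) (T F U hU x ⧸ I) := isSimpleModule_iff_isCoatom.2 hI.out
  set r' : T F U hU x := ⟨coord t r, hr⟩
  set z' : T F U hU x := ⟨coord t z, hz⟩
  let P : Submodule F (T F U hU x ⧸ I) :=
    LinearMap.range (Algebra.lsmul F F (T F U hU x ⧸ I) r')
  have hP : ∀ m, r' • m ∈ P := fun m => ⟨m, rfl⟩
  have hJ' : (coordOnes t : T F U hU x) * r' = c • r' + z' := by
    refine Subtype.ext ?_
    change coord t _ * coord t r = c • coord t r + coord t z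
    rw [← map_mul, hJ, map_add, map_smul]
  have hE' : ∀ v, (coordDual t v : T F U hU x) * r' = d v • r' := by
    intro v
    refine Subtype.ext ?_
    change coord t _ * coord t r = d v • coord t r
    rw [← map_mul, hE, map_smul]
  have hrr' : r' * r' = 0 := by
    refine Subtype.ext ?_
    change coord t r * coord t r = 0
    rw [← map_mul, hrr, map_zero]
  have h1 : ∀ s, ∀ m ∈ P, (coordOnes s : T F U hU x) • m ∈ P := by
    rintro s _ ⟨m, rfl⟩
    change (coordOnes s : T F U hU x) • r' • m ∈ P
    rw [← mul_smul]
    by_cases hs : s = t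
    · subst hs
      rw [hJ', add_smul, IsSimpleModule.smul_eq_zero_of_mem_jacobson hz', add_zero, smul_assoc]
      exact P.smul_mem _ (hP m)
    · have : (coordOnes s : T F U hU x) * r' = r' * coordOnes s :=
        Subtype.ext (coord_commute hs _ _)
      rw [this, mul_smul]
      exact hP _
  have h2 : ∀ s v, ∀ m ∈ P, (coordDual s v : T F U hU x) • m ∈ P := by
    rintro s v _ ⟨m, rfl⟩
    change (coordDual s v : T F U hU x) • r' • m ∈ P
    rw [← mul_smul]
    by_cases hs : s = t
    · subst hs
      rw [hE', smul_assoc]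
      exact P.smul_mem _ (hP m)
    · have : (coordDual s v : T F U hU x) * r' = r' * coordDual s v :=
        Subtype.ext (coord_commute hs _ _)
      rw [this, mul_smul]
      exact hP _
  let Q : Submodule (T F U hU x) (T F U hU x ⧸ I) :=
    { P with smul_mem' := fun a m hm => smul_mem_of_coord_smul_mem h1 h2 a hm }
  have hzero : r' • (Submodule.Quotient.mk 1 : T F U hU x ⧸ I) = 0 := by
    rcases eq_bot_or_eq_top Q with h | h
    · have : r' • (Submodule.Quotient.mk 1 : T F U hU x ⧸ I) ∈ Q := hP _
      rwa [h, Submodule.mem_bot] at this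
    · obtain ⟨m, hm⟩ : (Submodule.Quotient.mk 1 : T F U hU x ⧸ I) ∈ Q := h ▸ Submodule.mem_top
      rw [← hm]
      change r' • r' • m = 0
      rw [← mul_smul, hrr', zero_smul]
  rw [← Submodule.Quotient.mk_smul, smul_eq_mul, mul_one] at hzero
  exact (Submodule.Quotient.mk_eq_zero I).1 hzero

theorem block_mem_jacobson {t : Fin n} (ht : val F (U t) 1 = 0) {i j : Fin 2}
    (hij : ¬ (i = 0 ∧ j = 0)) :
    (⟨coord t (block F (x t) i j), coord_block_mem t i j⟩ : T F U hU x) ∈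
      Ring.jacobson (T F U hU x) := by
  have hE : ∀ (i j v : Fin 2),
      dualE F (x t) v * block F (x t) i j = (if v = i then 1 else 0 : F) • block F (x t) i j := by
    intro i j v
    rw [dualE_mul_block]
    split_ifs <;> simp
  have hz : (⟨coord t (0 : Matrix (U t) (U t) F), by rw [map_zero]; exact zero_mem _⟩ :
      T F U hU x) ∈ Ring.jacobson (T F U hU x) := by
    convert! zero_mem (Ring.jacobson (T F U hU x))
    exact map_zero _
  have h1 : ∀ j : Fin 2, (⟨coord t (block F (x t) 1 j), coord_block_mem t 1 j⟩ : T F U hU x) ∈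
      Ring.jacobson (T F U hU x) := by
    intro j
    refine coord_mem_jacobson (c := 0) _ _ hz ?_ (hE 1 j) ?_
    · rw [allOnes_mul_block, ht]; simp
    · rw [block_mul_block]
      by_cases h : j = 1
      · simp [h, ht]
      · simp [h]
  by_cases hi : i = 0
  · have hj : j = 1 := by omega
    subst hi hj
    refine coord_mem_jacobson (c := 1) _ _ (h1 1) ?_ (hE 0 1) ?_
    · rw [allOnes_mul_block]; simp
    · rw [block_mul_block]; simp
  · have hi : i = 1 := by omega
    subst hi
    exact h1 j

end FactorialScheme

/-! ### Matrix units of the Terwilliger algebra of a factorial scheme -/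

namespace FactorialScheme

open AssociationScheme TrivialScheme

section Valid

variable (F : Type v) [Field F] {n : ℕ} (U : Fin n → Type u)

/-- The sets of positions `t` with `|U_t| > 2`; these index the irreducible modules. -/
abbrev TypeSet : Type := {S : Finset (Fin n) // ∀ t ∈ S, 2 < Nat.card (U t)}

/-- The tuples that index the rows of the matrix algebra of type `S`: those that are `1` on `S` and
whose valency off `S` does not vanish in `F`. -/
def IsRow (S : Finset (Fin n)) (a : Fin n → Fin 2) : Prop :=
  ∀ t, if t ∈ S then a t = 1 else val F (U t) (a t) ≠ 0

variable {F U} {S : Finset (Fin n)} {a : Fin n → Fin 2} {t : Fin n}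

theorem IsRow.eq_one (h : IsRow F U S a) (ht : t ∈ S) : a t = 1 := by
  simpa only [if_pos ht] using h t

theorem IsRow.val_ne_zero (h : IsRow F U S a) (ht : t ∉ S) : val F (U t) (a t) ≠ 0 := by
  simpa only [if_neg ht] using h t

theorem IsRow.update (h : IsRow F U S a) (ht : t ∉ S) {v : Fin 2} (hv : val F (U t) v ≠ 0) :
    IsRow F U S (Function.update a t v) := by
  intro s
  by_cases hs : s = t
  · subst hs
    rwa [if_neg ht, Function.update_self]
  · rw [Function.update_of_ne hs]
    exact h s

end Valid

variable {F : Type v} [Field F] {n : ℕ} {U : Fin n → Type u} [∀ i, DecidableEq (U i)]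

section Cell

variable (F) (x : ∀ i, U i)

/-- The factors of the matrix unit of type `S` at position `(a, b)`. -/
def cell (S : Finset (Fin n)) (a b : Fin n → Fin 2) (t : Fin n) : Matrix (U t) (U t) F :=
  if t ∈ S then perp F (x t) else cross F (x t) (a t) (b t)

variable {F x} {S S' : Finset (Fin n)} {a b c d : Fin n → Fin 2} {t : Fin n}

theorem cell_of_mem (ht : t ∈ S) : cell F x S a b t = perp F (x t) := if_pos ht

theorem cell_of_notMem (ht : t ∉ S) : cell F x S a b t = cross F (x t) (a t) (b t) := if_neg ht

theorem cell_update (ht : t ∉ S) (v : Fin 2) : cell F x S (Function.update a t v) b =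
    Function.update (cell F x S a b) t (cross F (x t) v (b t)) := by
  funext s
  by_cases hs : s = t
  · subst hs
    rw [cell_of_notMem ht, Function.update_self, Function.update_self]
  · rw [Function.update_of_ne hs, cell, cell, Function.update_of_ne hs]

theorem cell_transpose (S : Finset (Fin n)) (a : Fin n → Fin 2) (t : Fin n) :
    (cell F x S a a t).transpose = cell F x S a a t := by
  by_cases ht : t ∈ S
  · rw [cell_of_mem ht, perp_transpose]
  · rw [cell_of_notMem ht, cross_transpose]

variable [∀ i, Fintype (U i)]

theorem cell_mul_cell (hb : IsRow F U S b) : cell F x S a b * cell F x S b d = cell F x S a d := by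
  funext t
  rw [Pi.mul_apply]
  by_cases ht : t ∈ S
  · rw [cell_of_mem ht, cell_of_mem ht, cell_of_mem ht, perp_mul_perp]
  · rw [cell_of_notMem ht, cell_of_notMem ht, cell_of_notMem ht,
      cross_mul_cross (hb.val_ne_zero ht), if_pos rfl]

theorem exists_cell_mul_eq_zero (hb : IsRow F U S b) (hc : IsRow F U S' c)
    (h : S ≠ S' ∨ b ≠ c) : ∃ t, (cell F x S a b * cell F x S' c d) t = 0 := by
  by_cases hS : S = S'
  · subst hS
    obtain ⟨t, ht⟩ := Function.ne_iff.1 (h.resolve_left (not_not.2 rfl))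
    have htS : t ∉ S := fun hmem => ht ((hb.eq_one hmem).trans (hc.eq_one hmem).symm)
    refine ⟨t, ?_⟩
    rw [Pi.mul_apply, cell_of_notMem htS, cell_of_notMem htS,
      cross_mul_cross (hb.val_ne_zero htS), if_neg ht]
  · obtain ⟨t, ht⟩ : ∃ t, ¬ (t ∈ S ↔ t ∈ S') := by
      by_contra! h'
      exact hS (Finset.ext h')
    refine ⟨t, ?_⟩
    rw [Pi.mul_apply]
    by_cases h1 : t ∈ S
    · have h2 : t ∉ S' := fun h2 => ht (iff_of_true h1 h2)
      rw [cell_of_mem h1, cell_of_notMem h2, perp_mul_cross _ (hc.val_ne_zero h2)]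
    · have h2 : t ∈ S' := by_contra fun h2 => ht (iff_of_false h1 h2)
      rw [cell_of_notMem h1, cell_of_mem h2, cross_mul_perp _ (hb.val_ne_zero h1)]

theorem cell_self_ne_zero (hU : ∀ i, 1 < Nat.card (U i)) (hS : ∀ t ∈ S, 2 < Nat.card (U t))
    (ha : IsRow F U S a) (t : Fin n) : ∃ y z, cell F x S a a t y z ≠ 0 := by
  by_cases ht : t ∈ S
  · rw [cell_of_mem ht]
    exact perp_ne_zero (hS t ht)
  · rw [cell_of_notMem ht]
    exact cross_self_ne_zero (hU t) (ha.val_ne_zero ht)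

end Cell

variable [∀ i, Fintype (U i)] {hU : ∀ i, 1 < Nat.card (U i)} {x : ∀ i, U i} {S : Finset (Fin n)}
  {a b h : Fin n → Fin 2} {t : Fin n}

theorem piMatrix_cell_mem (S : Finset (Fin n)) (a b : Fin n → Fin 2) :
    piMatrix (cell F x S a b) ∈ T F U hU x := by
  refine piMatrix_mem (B := (T F U hU x).toSubmonoid) fun t => ?_
  change coord t _ ∈ T F U hU x
  by_cases ht : t ∈ S
  · rw [cell_of_mem ht]
    exact coord_perp_mem t
  · rw [cell_of_notMem ht]
    exact coord_cross_mem t _ _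

/-- The matrix unit of type `S` at position `(a, b)`. -/
def unitT (S : Finset (Fin n)) (a b : Fin n → Fin 2) : T F U hU x :=
  ⟨piMatrix (cell F x S a b), piMatrix_cell_mem S a b⟩

theorem coordDual_mul_unitT (v : Fin 2) : ∃ c : F,
    (coordDual t v : T F U hU x) * unitT S a h = c • unitT S a h := by
  have hcell : ∃ c : F, dualE F (x t) v * cell F x S a h t = c • cell F x S a h t := by
    by_cases ht : t ∈ S
    · refine ⟨if v = 1 then 1 else 0, ?_⟩
      rw [cell_of_mem ht, dualE_mul_perp]
      split_ifs <;> simp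
    · refine ⟨if v = a t then 1 else 0, ?_⟩
      rw [cell_of_notMem ht, dualE_mul_cross]
      split_ifs <;> simp
  obtain ⟨c, hc⟩ := hcell
  exact ⟨c, Subtype.ext (coord_mul_piMatrix_of_mul_eq_smul hc)⟩

/-- On the factors in `S`, the all-ones matrix acts as `0` modulo the radical. -/
theorem coordOnes_mul_unitT_of_mem (ht : t ∈ S) :
    (coordOnes t : T F U hU x) * unitT S a h ∈ Ring.jacobson (T F U hU x) := by
  by_cases hv : val F (U t) 1 = 0
  · have heq : (coordOnes t : T F U hU x) * unitT S a h =
        ((⟨coord t (block F (x t) 0 1), coord_block_mem t 0 1⟩ : T F U hU x) +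
          ⟨coord t (block F (x t) 1 1), coord_block_mem t 1 1⟩) * unitT S a h := by
      refine Subtype.ext ?_
      change coord t _ * piMatrix _ = (coord t _ + coord t _) * piMatrix _
      rw [← map_add, coord_mul_piMatrix, coord_mul_piMatrix, cell_of_mem ht, perp, hv]
      rw [inv_zero, zero_smul, sub_zero, allOnes_mul_dualE, add_mul, block_mul_dualE,
        block_mul_dualE, if_pos rfl, if_pos rfl]
    rw [heq]
    exact Ideal.mul_mem_right _ _ (add_mem (block_mem_jacobson hv (by simp))
      (block_mem_jacobson hv (by simp)))
  · have heq : (coordOnes t : T F U hU x) * unitT S a h = 0 := by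
      refine Subtype.ext ?_
      change coord t _ * piMatrix _ = 0
      rw [coord_mul_piMatrix, cell_of_mem ht, allOnes_mul_perp hv]
      exact piMatrix_eq_zero (Function.update_self ..)
    rw [heq]
    exact zero_mem _

/-- On the factors outside of `S`, the all-ones matrix maps each matrix unit to a combination of
matrix units of the same column, modulo the radical. -/
theorem coordOnes_mul_unitT_of_notMem (ht : t ∉ S) (ha : IsRow F U S a) (hh : IsRow F U S h) :
    ∃ c : Fin 2 → F, (∀ v, c v ≠ 0 → val F (U t) v ≠ 0) ∧
      (coordOnes t : T F U hU x) * unitT S a h - ∑ v, c v • unitT S (Function.update a t v) h ∈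
        Ring.jacobson (T F U hU x) := by
  have hmul : (coordOnes t : T F U hU x) * unitT S a h = val F (U t) (a t) •
      (unitT S (Function.update a t 0) h + unitT S (Function.update a t 1) h) := by
    refine Subtype.ext ?_
    change coord t _ * piMatrix _ = val F (U t) (a t) • (piMatrix _ + piMatrix _)
    rw [coord_mul_piMatrix, cell_of_notMem ht, allOnes_mul_cross, piMatrix_update_smul,
      piMatrix_update_add, cell_update ht, cell_update ht]
  by_cases hv : val F (U t) 1 = 0
  · refine ⟨fun v => if v = 0 then 1 else 0, ?_, ?_⟩
    · intro v hne
      have : v = 0 := by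
        by_contra h0
        exact hne (if_neg h0)
      rw [this, val_zero]
      exact one_ne_zero
    have ha0 : a t = 0 := by
      have := ha.val_ne_zero ht
      by_contra h0
      exact this ((show a t = 1 by omega) ▸ hv)
    have hh0 : h t = 0 := by
      have := hh.val_ne_zero ht
      by_contra h0
      exact this ((show h t = 1 by omega) ▸ hv)
    have hrad : unitT S (Function.update a t 1) h =
        (⟨coord t (block F (x t) 1 0), coord_block_mem t 1 0⟩ : T F U hU x) * unitT S a h := by
      refine Subtype.ext ?_
      change piMatrix _ = coord t _ * piMatrix _
      rw [coord_mul_piMatrix, cell_update ht, cell_of_notMem ht, cross, cross, ha0, hh0,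
        mul_smul_comm, block_mul_block]
      simp
    rw [hmul, ha0, val_zero, one_smul, Fin.sum_univ_two]
    dsimp only
    rw [if_pos rfl, if_neg one_ne_zero, one_smul, zero_smul, add_zero, add_sub_cancel_left, hrad]
    exact Ideal.mul_mem_right _ _ (block_mem_jacobson hv (by simp))
  · refine ⟨fun _ => val F (U t) (a t), ?_, ?_⟩
    · intro v _
      by_cases h0 : v = 0
      · rw [h0, val_zero]; exact one_ne_zero
      · rwa [show v = 1 by omega]
    · rw [hmul, Fin.sum_univ_two, smul_add, sub_self]
      exact zero_mem _

/-- The admissible pairs on a single factor: `(true, 1)` stands for `perp`, and `(false, v)` for the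
diagonal matrix unit `cross v v`. -/
def IsIndex (F : Type v) [Field F] (W : Type u) (p : Bool × Fin 2) : Prop :=
  if p.1 then p.2 = 1 ∧ 2 < Nat.card W else val F W p.2 ≠ 0

open Classical in
theorem sum_diagonal {W : Type u} [Fintype W] [DecidableEq W] (x : W) (hW : 1 < Nat.card W) :
    ∑ p with IsIndex F W p, (if p.1 then perp F x else cross F x p.2 p.2) = 1 := by
  rw [Finset.sum_filter, Fintype.sum_prod_type, Fintype.sum_bool, Fin.sum_univ_two,
    Fin.sum_univ_two]
  have h0 : cross F x 0 0 = dualE F x 0 := by rw [cross, val_zero, inv_one, one_smul,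
    block_zero_zero]
  have h1 : val F W 1 ≠ 0 → cross F x 1 1 + perp F x = dualE F x 1 := fun _ => by
    rw [cross, perp]; abel
  have h2 : ¬ 2 < Nat.card W → Nat.card W = 2 := fun h => by omega
  by_cases hv : val F W 1 = 0
  · have hc : 2 < Nat.card W := by
      by_contra h
      rw [val, if_neg one_ne_zero, h2 h] at hv
      simp at hv
    have h3 : perp F x = dualE F x 1 := by rw [perp, hv]; simp
    simp [IsIndex, hv, hc, -Nat.card_eq_fintype_card, h0, h3]
    rw [add_comm, dualE_add]
  · by_cases hc : 2 < Nat.card W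
    · simp [IsIndex, hv, hc, -Nat.card_eq_fintype_card, h0]
      rw [← dualE_add x, ← h1 hv]
      abel
    · have h3 := h1 hv
      rw [perp_eq_zero (h2 hc), add_zero] at h3
      simp [IsIndex, hv, hc, -Nat.card_eq_fintype_card, h0, h3]
      rw [dualE_add]

theorem one_mem_span_unitT : (1 : T F U hU x) ∈ Submodule.span F
    {y | ∃ (k : TypeSet U) (a : Fin n → Fin 2), IsRow F U k.1 a ∧ y = unitT k.1 a a} := by
  classical
  have hone : (1 : Matrix (∀ t, U t) (∀ t, U t) F) =
      ∑ f : Fin n → Bool × Fin 2 with ∀ t, IsIndex F (U t) (f t),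
        piMatrix fun t => if (f t).1 then perp F (x t) else cross F (x t) (f t).2 (f t).2 := by
    rw [sum_piMatrix (fun t p => IsIndex F (U t) p)
      fun t p => if p.1 then perp F (x t) else cross F (x t) p.2 p.2, ← piMatrix_one]
    congr 1
    funext t
    exact (sum_diagonal (x t) (hU t)).symm
  suffices hmap : (1 : Matrix (∀ t, U t) (∀ t, U t) F) ∈ (Submodule.span F
      {y | ∃ (k : TypeSet U) (a : Fin n → Fin 2), IsRow F U k.1 a ∧ y = unitT k.1 a a}).map
        (T F U hU x).val.toLinearMap by
    obtain ⟨r, hr, hr1⟩ := hmap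
    rwa [← (Subtype.ext hr1 : r = 1)]
  rw [hone]
  refine sum_mem fun f hf => ?_
  have hf : ∀ t, IsIndex F (U t) (f t) := by simpa using hf
  let S : Finset (Fin n) := {t | (f t).1}
  have hmem : ∀ t, t ∈ S ↔ (f t).1 = true := fun t => by simp [S]
  refine ⟨unitT S (fun t => (f t).2) fun t => (f t).2,
    Submodule.subset_span ⟨⟨S, fun t ht => ?_⟩, fun t => (f t).2, fun t => ?_, rfl⟩, ?_⟩
  · have := hf t
    rw [IsIndex, if_pos ((hmem t).1 ht)] at this
    exact this.2
  · have := hf t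
    rw [IsIndex] at this
    by_cases ht : t ∈ S
    · rw [if_pos ((hmem t).1 ht)] at this
      rw [if_pos ht]
      exact this.1
    · rw [if_neg fun h => ht ((hmem t).2 h)] at this
      rwa [if_neg ht]
  · change piMatrix _ = piMatrix _
    congr 1
    funext t
    rw [cell]
    exact if_congr (hmem t) rfl rfl

theorem mk_mul_unitT_mem (ha : IsRow F U S a) (hh : IsRow F U S h) (r : T F U hU x) :
    Ideal.Quotient.mk (Ring.jacobson (T F U hU x)) (r * unitT S a h) ∈
      Submodule.span F {y | ∃ b, IsRow F U S b ∧
        y = Ideal.Quotient.mk (Ring.jacobson (T F U hU x)) (unitT S b h)} := by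
  set P := Submodule.span F {y | ∃ b, IsRow F U S b ∧
    y = Ideal.Quotient.mk (Ring.jacobson (T F U hU x)) (unitT S b h)}
  have hP : ∀ b, IsRow F U S b →
      Ideal.Quotient.mk (Ring.jacobson (T F U hU x)) (unitT S b h) ∈ P :=
    fun b hb => Submodule.subset_span ⟨b, hb, rfl⟩
  have hclosed : ∀ r : T F U hU x,
      (∀ b, IsRow F U S b → Ideal.Quotient.mk (Ring.jacobson (T F U hU x)) (r * unitT S b h) ∈ P) →
      ∀ m ∈ P, r • m ∈ P := by
    intro r hr m hm
    induction hm using Submodule.span_induction with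
    | mem y hy =>
      obtain ⟨b, hb, rfl⟩ := hy
      exact hr b hb
    | zero => rw [smul_zero]; exact zero_mem _
    | add y z _ _ hy hz => rw [smul_add]; exact add_mem hy hz
    | smul c y _ hy => rw [smul_comm]; exact Submodule.smul_mem _ c hy
  refine smul_mem_of_coord_smul_mem (fun t => hclosed _ fun b hb => ?_)
    (fun t v => hclosed _ fun b hb => ?_) r (hP a ha)
  · by_cases ht : t ∈ S
    · rw [Ideal.Quotient.eq_zero_iff_mem.2 (coordOnes_mul_unitT_of_mem ht)]
      exact zero_mem _
    · obtain ⟨c, hc, hrad⟩ := coordOnes_mul_unitT_of_notMem (hU := hU) (x := x) ht hb hh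
      have hv : ∀ v, c v • Ideal.Quotient.mk (Ring.jacobson (T F U hU x))
          (unitT S (Function.update b t v) h) ∈ P := by
        intro v
        by_cases h0 : c v = 0
        · rw [h0, zero_smul]
          exact zero_mem _
        · exact P.smul_mem (c v) (hP _ (hb.update ht (hc v h0)))
      rw [Fin.sum_univ_two] at hrad
      rw [(Ideal.Quotient.mk_eq_mk_iff_sub_mem _ _).2 hrad]
      exact P.add_mem (hv 0) (hv 1)
  · obtain ⟨c, hc⟩ := coordDual_mul_unitT (F := F) (hU := hU) (x := x) (S := S) (a := b) (h := h)
      (t := t) v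
    rw [hc]
    exact P.smul_mem c (hP b hb)

variable (F hU x) in
/-- The matrix units of the Terwilliger algebra of a factorial scheme. -/
def matrixUnits : MatrixUnits F (T F U hU x) (TypeSet U) (Fin n → Fin 2) where
  Valid k a := IsRow F U k.1 a
  e k a b := unitT k.1 a b
  mul_same _ hb _ := Subtype.ext
    ((piMatrix_mul _ _).trans (congrArg piMatrix (cell_mul_cell (F := F) (x := x) hb)))
  mul_ne {k a b k' c d} _ hb hc _ h := by
    have h' : k.1 ≠ k'.1 ∨ b ≠ c := h.imp_left fun hk hk' => hk (Subtype.ext hk')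
    obtain ⟨t, ht⟩ := exists_cell_mul_eq_zero (F := F) (x := x) (a := a) (d := d) hb hc h'
    exact Subtype.ext ((piMatrix_mul _ _).trans (piMatrix_eq_zero ht))
  one_mem := one_mem_span_unitT
  ne_zero {k a} ha h0 :=
    piMatrix_ne_zero (cell_self_ne_zero (F := F) (x := x) hU k.2 ha) (congrArg Subtype.val h0)
  mul_mem ha hh r := mk_mul_unitT_mem ha hh r

end FactorialScheme

namespace FactorialScheme

open AssociationScheme TrivialScheme

/-! ### Equivalence classes and types -/

variable {F : Type v} [Field F] {n : ℕ} {U : Fin n → Type u}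

theorem mem_supp {g : Fin n → Fin 2} {t : Fin n} : t ∈ supp g ↔ g t = 1 := by simp [supp]

theorem supp_ofSupp (V : Finset (Fin n)) : supp (ofSupp V) = V := by
  ext t
  simp [mem_supp, ofSupp]

theorem mem_circ {V : Finset (Fin n)} {t : Fin n} :
    t ∈ circ U V ↔ t ∈ V ∧ 2 < Nat.card (U t) := by simp [circ]

theorem mem_symmDiff_supp {g i : Fin n → Fin 2} {t : Fin n} :
    t ∈ supp g ∆ supp i ↔ g t ≠ i t := by
  rw [Finset.mem_symmDiff, mem_supp, mem_supp]
  omega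

theorem tupleMul_eq_one {g i : Fin n → Fin 2} {t : Fin n} : tupleMul U g i t = 1 ↔
    g t ≠ i t ∨ (g t = 1 ∧ i t = 1 ∧ 2 < Nat.card (U t)) := by
  rw [tupleMul, ← mem_supp, supp_ofSupp, Finset.mem_union, mem_symmDiff_supp, mem_circ,
    Finset.mem_inter, mem_supp, mem_supp, and_assoc]

theorem mem_circ_sdiff {a b c : Fin n → Fin 2} {t : Fin n} :
    t ∈ circ U (supp a ∩ supp c) \ supp b ↔
      (a t = 1 ∧ c t = 1 ∧ 2 < Nat.card (U t)) ∧ b t ≠ 1 := by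
  rw [Finset.mem_sdiff, mem_circ, Finset.mem_inter, mem_supp, mem_supp, mem_supp,
    and_assoc (a := a t = 1)]

theorem isRow_ofSupp (S : Finset (Fin n)) : IsRow F U S (ofSupp S) := by
  intro t
  by_cases ht : t ∈ S
  · simp [ht, ofSupp]
  · simp [ht, ofSupp]

variable [∀ i, Fintype (U i)] {hU : ∀ i, 1 < Nat.card (U i)}

theorem cast_valency (g : Fin n → Fin 2) :
    ((factorial U hU).valency g : F) = ∏ t, val F (U t) (g t) := by
  have h : (factorial U hU).valency g = ∏ t, trivialP (U t) (g t) (g t) 0 := rfl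
  rw [h, Nat.cast_prod]
  refine Finset.prod_congr rfl fun t _ => ?_
  by_cases hg : g t = 0
  · simp [hg, trivialP]
  · simp [hg, trivialP, val]

theorem not_dvd_valency {g : Fin n → Fin 2} :
    ¬ ringChar F ∣ (factorial U hU).valency g ↔ ∀ t, val F (U t) (g t) ≠ 0 := by
  rw [← ringChar.spec, cast_valency, Finset.prod_eq_zero_iff]
  simp

theorem mem_setD {a b c : Fin n → Fin 2} : (a, b, c) ∈ setD F U hU ↔
    ∀ t, (a t ≠ c t → b t = 1) ∧
      (b t = 1 → a t ≠ c t ∨ (a t = 1 ∧ c t = 1 ∧ 2 < Nat.card (U t))) ∧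
      val F (U t) (b t) ≠ 0 := by
  simp only [setD, setP, Set.mem_ofPred_eq, not_dvd_valency, Finset.subset_iff, Finset.mem_union,
    mem_symmDiff_supp, mem_circ, Finset.mem_inter, mem_supp, forall_and, and_assoc]

theorem card_sdiff_le_numN {l h k : Fin n → Fin 2} (hk : supp l ⊆ supp k)
    (hl : ¬ ringChar F ∣ (factorial U hU).valency l) : (supp l \ supp h).card ≤ numN F U k h := by
  refine Finset.card_le_card fun t ht => ?_
  rw [Finset.mem_sdiff] at ht
  rw [Finset.mem_filter, Finset.mem_sdiff, ← ringChar.spec]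
  refine ⟨⟨hk ht.1, ht.2⟩, ?_⟩
  have := not_dvd_valency.1 hl t
  rwa [mem_supp.1 ht.1] at this

/-- The type of the class of `(a, b, c)` is `(a ∩ c)° \ b`. -/
def SimClass.type (m : SimClass F U hU) : TypeSet U :=
  Quotient.lift (fun t : setD F U hU =>
    (⟨circ U (supp t.1.1 ∩ supp t.1.2.2) \ supp t.1.2.1,
      fun _ hs => (mem_circ_sdiff.1 hs).1.2.2⟩ : TypeSet U)) (fun _ _ h => Subtype.ext h) m

theorem SimClass.type_injective : Function.Injective (SimClass.type : SimClass F U hU → _) := by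
  intro m m' h
  induction m using Quotient.inductionOn with | _ t
  induction m' using Quotient.inductionOn with | _ t'
  exact Quotient.sound (congrArg Subtype.val h)

theorem SimClass.mem_toSet {m : SimClass F U hU} {a b c : Fin n → Fin 2} :
    (a, b, c) ∈ m.toSet ↔
      (a, b, c) ∈ setD F U hU ∧ circ U (supp a ∩ supp c) \ supp b = m.type.1 := by
  constructor
  · rintro ⟨ht, rfl⟩
    exact ⟨ht, rfl⟩
  · rintro ⟨ht, h⟩
    exact ⟨ht, SimClass.type_injective (Subtype.ext h)⟩

theorem exists_mem_setD {S : TypeSet U} {a h : Fin n → Fin 2} (ha : IsRow F U S.1 a)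
    (hh : IsRow F U S.1 h) :
    ∃ b, (a, b, h) ∈ setD F U hU ∧ circ U (supp a ∩ supp h) \ supp b = S.1 := by
  refine ⟨ofSupp (supp a ∆ supp h ∪ (circ U (supp a ∩ supp h) \ S.1)), ?_, ?_⟩
  · have hb : ∀ t, ofSupp (supp a ∆ supp h ∪ (circ U (supp a ∩ supp h) \ S.1)) t = 1 ↔
        a t ≠ h t ∨ (a t = 1 ∧ h t = 1 ∧ 2 < Nat.card (U t)) ∧ t ∉ S.1 := by
      intro t
      rw [← mem_supp, supp_ofSupp, Finset.mem_union, mem_symmDiff_supp, Finset.mem_sdiff, mem_circ,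
        Finset.mem_inter, mem_supp, mem_supp, and_assoc (a := a t = 1)]
    rw [mem_setD]
    intro t
    refine ⟨fun hne => (hb t).2 (Or.inl hne), fun h1 => ((hb t).1 h1).imp_right And.left, ?_⟩
    by_cases h1 : ofSupp (supp a ∆ supp h ∪ (circ U (supp a ∩ supp h) \ S.1)) t = 1
    · rw [h1]
      rcases (hb t).1 h1 with hne | ⟨⟨hat, _⟩, hS⟩
      · have hS : t ∉ S.1 := fun hS => hne ((ha.eq_one hS).trans (hh.eq_one hS).symm)
        have h2 := ha.val_ne_zero hS
        have h3 := hh.val_ne_zero hS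
        by_cases hat : a t = 1
        · rwa [hat] at h2
        · rwa [show h t = 1 by omega] at h3
      · have h2 := ha.val_ne_zero hS
        rwa [hat] at h2
    · rw [show ofSupp _ t = 0 by omega, val_zero]
      exact one_ne_zero
  · ext t
    rw [supp_ofSupp, Finset.mem_sdiff, Finset.mem_union, mem_symmDiff_supp, Finset.mem_sdiff,
      mem_circ, Finset.mem_inter, mem_supp, mem_supp]
    constructor
    · rintro ⟨h1, h2⟩
      by_contra hS
      exact h2 (Or.inr ⟨h1, hS⟩)
    · intro hS
      have h1 := ha.eq_one hS
      have h2 := hh.eq_one hS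
      refine ⟨⟨⟨h1, h2⟩, S.2 t hS⟩, ?_⟩
      rintro (hne | ⟨_, hS'⟩)
      · exact hne (h1.trans h2.symm)
      · exact hS' hS

theorem SimClass.type_surjective : Function.Surjective (SimClass.type : SimClass F U hU → _) := by
  intro S
  obtain ⟨b, hb, hS⟩ := exists_mem_setD (hU := hU) (isRow_ofSupp (F := F) S.1) (isRow_ofSupp S.1)
  exact ⟨Quotient.mk _ ⟨_, hb⟩, Subtype.ext hS⟩

theorem SimClass.mem_index {m : SimClass F U hU} {a : Fin n → Fin 2} :
    a ∈ m.index ↔ IsRow F U m.type.1 a := by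
  constructor
  · rintro ⟨b, hb⟩
    obtain ⟨hD, hS⟩ := SimClass.mem_toSet.1 hb
    rw [mem_setD] at hD
    intro t
    rw [← hS]
    by_cases ht : t ∈ circ U (supp a ∩ supp a) \ supp b
    · rw [if_pos ht]
      exact (mem_circ_sdiff.1 ht).1.1
    · rw [if_neg ht]
      rw [mem_circ_sdiff] at ht
      by_cases hat : a t = 1
      · rw [hat]
        by_cases hc : 2 < Nat.card (U t)
        · have hbt : b t = 1 := by
            by_contra h1
            exact ht ⟨⟨hat, hat, hc⟩, h1⟩
          exact hbt ▸ (hD t).2.2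
        · rw [val, if_neg one_ne_zero, show Nat.card (U t) - 1 = 1 by have := hU t; omega]
          simp
      · rw [show a t = 0 by omega, val_zero]
        exact one_ne_zero
  · intro ha
    obtain ⟨b, hb⟩ := exists_mem_setD (hU := hU) ha ha
    exact ⟨b, SimClass.mem_toSet.2 hb⟩

/-! ### The matrices `D_{g,h,i}` as matrix units -/

theorem sign_eq_prod (l h : Fin n → Fin 2) : (-1 : F) ^ (supp l \ supp h).card =
    ∏ t, if l t = 1 ∧ h t ≠ 1 then -1 else 1 := by
  rw [Finset.prod_ite, Finset.prod_const, Finset.prod_const_one, mul_one]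
  congr 2
  ext t
  simp [mem_supp]

variable [∀ i, DecidableEq (U i)] {x : ∀ i, U i}

theorem coe_matB {g l i : Fin n → Fin 2} (h : ∀ t, g t ≠ i t → l t = 1) :
    (matB F U hU x g l i).1 = piMatrix fun t =>
      if l t = 1 then block F (x t) (g t) (i t) else dualE F (x t) (g t) := by
  have h1 : ∀ j, (factorial U hU).dualIdempotent F x g * (factorial U hU).adjMatrix F j *
      (factorial U hU).dualIdempotent F x i = piMatrix fun t => dualE F (x t) (g t) *
        (if j t = 0 then 1 else allOnes F (U t) - 1) * dualE F (x t) (i t) := by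
    intro j
    rw [dualIdempotent_eq, dualIdempotent_eq, adjMatrix_eq, piMatrix_mul, piMatrix_mul]
    rfl
  have h2 : (matB F U hU x g l i).1 =
      ∑ j with supp g ∆ supp i ⊆ supp j ∧ supp j ⊆ supp l,
        (factorial U hU).dualIdempotent F x g * (factorial U hU).adjMatrix F j *
          (factorial U hU).dualIdempotent F x i := by
    rw [matB, AddSubmonoidClass.coe_finsetSum]
    rfl
  rw [h2, Finset.sum_congr rfl fun j _ => h1 j]
  have h3 := sum_piMatrix (fun t (v : Fin 2) => (g t ≠ i t → v = 1) ∧ (v = 1 → l t = 1))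
    fun t v => dualE F (x t) (g t) * (if v = 0 then 1 else allOnes F (U t) - 1) *
      dualE F (x t) (i t)
  simp only [sum_dualE_mul_mul_dualE (h _)] at h3
  rw [← h3]
  refine Finset.sum_congr ?_ fun _ _ => rfl
  ext j
  simp only [Finset.mem_filter, Finset.mem_univ, true_and, Finset.subset_iff, mem_symmDiff_supp,
    mem_supp, forall_and]

/-- `D_{g,h,i}` is the tensor product of matrix units of the factors, since both the alternating sum
over `l` and the sum defining `B_{g,l,i}` are products of sums over the factors. -/
theorem matD_eq_unitT {g h i : Fin n → Fin 2} (hD : (g, h, i) ∈ setD F U hU) :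
    matD F U hU x g h i = unitT (circ U (supp g ∩ supp i) \ supp h) g i := by
  classical
  rw [mem_setD] at hD
  -- the sets that `l` runs over, for the different `k`, are the fibres of `l ↦ |l \ h|` on a set
  -- that is a product over the factors
  have hset : ∀ k, setU F U hU (tupleMul U g i) h k =
      {l ∈ ({l | ∀ t, (h t = 1 → l t = 1) ∧
        (l t = 1 → g t ≠ i t ∨ (g t = 1 ∧ i t = 1 ∧ 2 < Nat.card (U t))) ∧
          val F (U t) (l t) ≠ 0} : Finset (Fin n → Fin 2)) | (supp l \ supp h).card = k} := by
    intro k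
    ext l
    simp only [setU, Finset.mem_filter, Finset.mem_univ, true_and, Finset.subset_iff, mem_supp,
      tupleMul_eq_one, not_dvd_valency, forall_and, and_assoc]
  have hinner : ∀ k, ∑ l ∈ setU F U hU (tupleMul U g i) h k, ((-1 : F) ^ k *
      ((factorial U hU).valency (ofSupp (supp i ∩ supp l)) : F)⁻¹) • matB F U hU x g l i =
      ∑ l ∈ setU F U hU (tupleMul U g i) h k, ((-1 : F) ^ (supp l \ supp h).card *
        ((factorial U hU).valency (ofSupp (supp i ∩ supp l)) : F)⁻¹) • matB F U hU x g l i := by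
    intro k
    refine Finset.sum_congr rfl fun l hl => ?_
    rw [hset, Finset.mem_filter] at hl
    rw [hl.2]
  rw [matD, Finset.sum_congr rfl fun k _ => hinner k]
  simp only [hset]
  rw [Finset.sum_fiberwise_of_maps_to]
  swap
  · intro l hl
    simp only [Finset.mem_filter, Finset.mem_univ, true_and] at hl
    rw [Finset.mem_range, Nat.lt_succ_iff]
    exact card_sdiff_le_numN (hU := hU)
      (fun t ht => mem_supp.2 (tupleMul_eq_one.2 ((hl t).2.1 (mem_supp.1 ht))))
      (not_dvd_valency.2 fun t => (hl t).2.2)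
  refine Subtype.ext ?_
  rw [AddSubmonoidClass.coe_finsetSum]
  have hterm : ∀ l : Fin n → Fin 2, (∀ t, g t ≠ i t → l t = 1) →
      ((((-1 : F) ^ (supp l \ supp h).card *
        ((factorial U hU).valency (ofSupp (supp i ∩ supp l)) : F)⁻¹) •
          matB F U hU x g l i : T F U hU x) : Matrix (∀ t, U t) (∀ t, U t) F) =
      piMatrix fun t => ((if l t = 1 ∧ h t ≠ 1 then -1 else 1) *
        (val F (U t) (if i t = 1 ∧ l t = 1 then 1 else 0))⁻¹ : F) •
          (if l t = 1 then block F (x t) (g t) (i t) else dualE F (x t) (g t)) := by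
    intro l hl
    have h1 : ∀ t, ofSupp (supp i ∩ supp l) t = if i t = 1 ∧ l t = 1 then 1 else 0 := fun t => by
      simp [ofSupp, mem_supp]
    have h2 : ((-1 : F) ^ (supp l \ supp h).card *
        ((factorial U hU).valency (ofSupp (supp i ∩ supp l)) : F)⁻¹) =
        ∏ t, ((if l t = 1 ∧ h t ≠ 1 then -1 else 1) *
          (val F (U t) (if i t = 1 ∧ l t = 1 then 1 else 0))⁻¹ : F) := by
      rw [Finset.prod_mul_distrib, sign_eq_prod, cast_valency, ← Finset.prod_inv_distrib]
      simp only [h1]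
    rw [← prod_smul_piMatrix, ← coe_matB (hU := hU) hl, h2]
    rfl
  rw [Finset.sum_congr rfl fun l hl => hterm l fun t ht =>
    ((Finset.mem_filter.1 hl).2 t).1 ((hD t).1 ht)]
  have h3 := sum_piMatrix (fun t v => (h t = 1 → v = 1) ∧
      (v = 1 → g t ≠ i t ∨ (g t = 1 ∧ i t = 1 ∧ 2 < Nat.card (U t))) ∧ val F (U t) v ≠ 0)
    fun t v => ((if v = 1 ∧ h t ≠ 1 then -1 else 1) *
        (val F (U t) (if i t = 1 ∧ v = 1 then 1 else 0))⁻¹ : F) •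
          (if v = 1 then block F (x t) (g t) (i t) else dualE F (x t) (g t))
  have h4 : ∀ t, _ = _ := fun t => sum_sign_smul (F := F) (x := x t) (hU t) (hD t).2.1 (hD t).1
    fun h1 => by simpa [h1] using (hD t).2.2
  simp only [h4] at h3
  refine h3.trans ?_
  change piMatrix _ = piMatrix _
  congr 1
  funext t
  exact if_congr mem_circ_sdiff.symm rfl rfl

theorem irrGenerators_eq_column {m : SimClass F U hU} {h : Fin n → Fin 2} (hh : h ∈ m.index) :
    irrGenerators x m h = (matrixUnits F hU x).column m.type h := by
  ext y
  constructor
  · rintro ⟨a, b, ha, hb, rfl⟩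
    obtain ⟨hD, hS⟩ := SimClass.mem_toSet.1 hb
    refine ⟨a, SimClass.mem_index.1 ha, ?_⟩
    rw [matD_eq_unitT hD, hS]
    rfl
  · rintro ⟨a, ha, rfl⟩
    obtain ⟨b, hD, hS⟩ := exists_mem_setD (hU := hU) ha (SimClass.mem_index.1 hh)
    refine ⟨a, b, SimClass.mem_index.2 ha, SimClass.mem_toSet.2 ⟨hD, hS⟩, ?_⟩
    rw [matD_eq_unitT hD, hS]
    rfl

theorem Irr_eq_irr {m : SimClass F U hU} {h : Fin n → Fin 2} (hh : h ∈ m.index) :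
    Irr x m h = (matrixUnits F hU x).irr m.type h :=
  congrArg (Submodule.span _) (irrGenerators_eq_column hh)

/-! ### Transposition -/

theorem transposeT_transposeT (f : T F U hU x) :
    ((factorial U hU).transposeT F x ((factorial U hU).transposeT F x f).unop).unop = f := rfl

theorem transposeT_unitT (k : TypeSet U) (a : Fin n → Fin 2) :
    ((factorial U hU).transposeT F x ((matrixUnits F hU x).e k a a)).unop =
      (matrixUnits F hU x).e k a a :=
  Subtype.ext ((piMatrix_transpose _).trans (congrArg piMatrix (funext (cell_transpose k.1 a))))

end FactorialScheme

end

theorem mainTheorem11 {F : Type v} [Field F] {n : ℕ} (hn : 1 ≤ n) (U : Fin n → Type u)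
    [∀ i, Fintype (U i)] [∀ i, DecidableEq (U i)] (hU : ∀ i, 1 < Nat.card (U i))
    (x : ∀ i, U i) :
    -- the classes, and the index sets of the modules `Irr`
    Finite (FactorialScheme.SimClass F U hU) ∧ Nonempty (FactorialScheme.SimClass F U hU) ∧
    (∀ g : FactorialScheme.SimClass F U hU, g.index.Nonempty) ∧
    -- each `Irr(g)` is the `F`-span of its generators, and is irreducible
    (∀ g : FactorialScheme.SimClass F U hU, ∀ h ∈ g.index,
      (FactorialScheme.Irr x g h).restrictScalars F =
        Submodule.span F (FactorialScheme.irrGenerators x g h) ∧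
      IsSimpleModule (FactorialScheme.T F U hU x) (FactorialScheme.Irr x g h)) ∧
    -- `Irr(g) ≅ Irr(g')` if and only if `g = g'`
    (∀ g g' : FactorialScheme.SimClass F U hU, ∀ h ∈ g.index, ∀ h' ∈ g'.index,
      (g = g' ↔ Nonempty (FactorialScheme.Irr x g h ≃ₗ[FactorialScheme.T F U hU x]
        FactorialScheme.Irr x g' h'))) ∧
    -- every irreducible module is isomorphic to some `Irr(g)`
    (∀ (M : Type w) [AddCommGroup M] [Module (FactorialScheme.T F U hU x) M],
      IsSimpleModule (FactorialScheme.T F U hU x) M →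
      ∃ g : FactorialScheme.SimClass F U hU, ∀ h ∈ g.index,
        Nonempty (M ≃ₗ[FactorialScheme.T F U hU x] FactorialScheme.Irr x g h)) ∧
    -- irreducible modules are the same as absolutely irreducible modules
    (∀ (M : Type w) [AddCommGroup M] [Module F M] [Module (FactorialScheme.T F U hU x) M]
      [IsScalarTower F (FactorialScheme.T F U hU x) M],
      IsSimpleModule (FactorialScheme.T F U hU x) M ↔
        IsAbsolutelyIrreducible.{v, w'} F (FactorialScheme.T F U hU x) M) ∧
    -- irreducible modules are self-contragredient with respect to transposition
    (∀ (M : Type w) [AddCommGroup M] [Module F M] [Module (FactorialScheme.T F U hU x) M]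
      [IsScalarTower F (FactorialScheme.T F U hU x) M],
      IsSimpleModule (FactorialScheme.T F U hU x) M →
        IsSelfContragredient ((AssociationScheme.factorial U hU).transposeT F x) M) := by
  have hirr : ∀ (g : FactorialScheme.SimClass F U hU), ∀ h ∈ g.index,
      FactorialScheme.Irr x g h = (FactorialScheme.matrixUnits F hU x).irr g.type h :=
    fun g h hh => FactorialScheme.Irr_eq_irr hh
  have hrow : ∀ (g : FactorialScheme.SimClass F U hU), ∀ h ∈ g.index,
      (FactorialScheme.matrixUnits F hU x).Valid g.type h :=
    fun g h hh => FactorialScheme.SimClass.mem_index.1 hh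
  refine ⟨inferInstance, ?_, ?_, ?_, ?_, ?_, ?_, ?_⟩
  · obtain ⟨g, -⟩ := FactorialScheme.SimClass.type_surjective (F := F) (hU := hU) ⟨∅, by simp⟩
    exact ⟨g⟩
  · exact fun g => ⟨_, FactorialScheme.SimClass.mem_index.2 (FactorialScheme.isRow_ofSupp g.type.1)⟩
  · intro g h hh
    rw [hirr g h hh, FactorialScheme.irrGenerators_eq_column hh]
    exact ⟨MatrixUnits.restrictScalars_irr (hrow g h hh),
      MatrixUnits.isSimpleModule_irr (hrow g h hh)⟩
  · intro g g' h hh h' hh'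
    rw [hirr g h hh, hirr g' h' hh']
    refine ⟨?_, fun ⟨f⟩ => FactorialScheme.SimClass.type_injective
      (MatrixUnits.eq_of_equiv_irr (hrow g h hh) (hrow g' h' hh') f)⟩
    rintro rfl
    have := MatrixUnits.isSimpleModule_irr (hrow g h hh)
    exact MatrixUnits.nonempty_equiv_irr_of_valid (hrow g h hh) (hrow g h' hh')
  · intro M _ _ _
    let _ : Module F M := Module.compHom M (algebraMap F (FactorialScheme.T F U hU x))
    have : IsScalarTower F (FactorialScheme.T F U hU x) M :=
      ⟨fun c r m => by rw [Algebra.smul_def, mul_smul]; rfl⟩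
    obtain ⟨k, a, ha, m, hm⟩ := (FactorialScheme.matrixUnits F hU x).exists_e_smul_ne_zero (M := M)
    obtain ⟨g, rfl⟩ := FactorialScheme.SimClass.type_surjective (F := F) (hU := hU) k
    refine ⟨g, fun h hh => ?_⟩
    rw [hirr g h hh]
    obtain ⟨m', hm'⟩ := MatrixUnits.e_smul_ne_zero_of_valid ha (hrow g h hh) hm
    exact MatrixUnits.nonempty_equiv_irr (hrow g h hh) hm'
  · intro M _ _ _ _
    exact ⟨fun _ => (FactorialScheme.matrixUnits F hU x).isAbsolutelyIrreducible M,
      fun hM => hM.isSimpleModule⟩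
  · intro M _ _ _ _ _
    exact (FactorialScheme.matrixUnits F hU x).isSelfContragredient _
      FactorialScheme.transposeT_transposeT FactorialScheme.transposeT_unitT
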